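/- Let $M,H,d\ge 1$ and let participant $m\in\{1,\dots,M\}$ own finitely many samples with differentiable losses $f_m^i:\mathbb{R}^d\to\mathbb{R}$, $i\in\mathcal D_m$. Put $f_m=\frac1{|\mathcal D_m|}\sum_{i\in\mathcal D_m} f_m^i$, $F=\frac1M\sum_m f_m$, and suppose $F^*=\inf F>-\infty$. The algorithm (local SGD with $\mathrm{Top}_k$ sparsification, error compensation and growing mini-batches), run for $T=KH\ge2$ iterations, that is, for $K$ communication rounds, with learning rate $\eta$ and batch factor $\rho$, is the following. Start from a random $w^{(0)}$ with $\widehat w_m^{(0)}=w^{(0)}$ and $e_m^{(0)}=0$. At iteration $t=0,\dots,T-1$ each participant draws a uniformly random mini-batch $\mathcal D_m^{(t)}$ of size $b^{(t)}=\lfloor\rho^t b^{(0)}\rfloor$ from $\mathcal D_m$ (all draws with replacement, or all without; independent over $m,t$ and of $w^{(0)}$) and sets $\widehat w_m^{(t+1/2)}=\widehat w_m^{(t)}-\eta\nabla f_m(\widehat w_m^{(t)};\mathcal D_m^{(t)})$, where $\nabla f_m(w;\mathcal D)$ is the average of $\nabla f_m^i(w)$ over $\mathcal D$. If $H\mid t+1$,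 set $u_m=e_m^{(t)}+w^{(t)}-\widehat w_m^{(t+1/2)}$, $g_m=\mathrm{Top}_{k_m}(u_m)$, $e_m^{(t+1)}=u_m-g_m$ and $\widehat w_m^{(t+1)}=w^{(t+1)}=w^{(t)}-\frac1M\sum_{j} g_j$; otherwise $\widehat w_m^{(t+1)}=\widehat w_m^{(t+1/2)}$, $w^{(t+1)}=w^{(t)}$, $e_m^{(t+1)}=e_m^{(t)}$. Here $1\le k_m\le d$, and $\mathrm{Top}_k(x)$ keeps the entries of $x$ whose absolute value is at least the $k$-th largest absolute value and replaces the others by $0$. Put $\delta_m=d/k_m$ and $\delta=\sqrt{\frac1M\sum_m\delta_m^2}$. Let $z_T$ equal $\widehat w_m^{(t)}$ for an independent, uniformly random pair $(m,t)\in\{1,\dots,M\}\times\{0,\dots,T-1\}$. Assume that each $\nabla f_m$ is $L$-Lipschitz ($L>0$), and that for constants $0<\sigma\le G$, all $m$, all $w\in\mathbb{R}^d$ and all $0\le t<T$, $$\mathbb{E}_{\mathcal D_m^{(t)}}\|\nabla f_m(w;\mathcal D_m^{(t)})-\nabla f_m(w)\|^2\le\sigma^2,\qquad \mathbb{E}_{\mathcal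 D_m^{(t)}}\|\nabla f_m(w;\mathcal D_m^{(t)})\|^2\le G^2 .$$ Let $b^{(0)}\ge1$ be an integer, $J,\varepsilon>0$, $F(w^{(0)})$ integrable, $\mathbb{E}[F(w^{(0)})]-F^*\le J^2$, and take $$\rho=\frac{T}{T-1},\qquad \eta=\frac{\theta\sqrt M}{\sqrt T},\qquad \theta\ge0,\quad \theta^2=\frac{b^{(0)}(\mathbb{E}[F(w^{(0)})]-F^*)}{\sigma^2L}.$$ Then the number of communication rounds needed for $\mathbb{E}\|\nabla F(z_T)\|^2\le\varepsilon$ is $\mathcal O(MH\delta^2)+\mathcal O\big(\frac1{\sqrt M H}\big)$. Precisely, there is a constant $C>0$ depending only on $\sigma,G,L,J,\varepsilon,b^{(0)}$ such that: 1. whenever $K\ge C\,MH\delta^2+C\,\frac1{\sqrt M H}$, one has $\mathbb{E}\|\nabla F(z_T)\|^2\le\varepsilon$; 2. if moreover the bound $\sigma^2$ on the variance holds for a single uniformly drawn sample (mini-batches of size $1$), then $\mathbb{E}\|\nabla F(z_T)\|^2\le\varepsilon$ whenever $K\ge K(\delta,H):=T(\delta,H)/H$, where $$T(\delta,H)=\tfrac{8b^{(0)}MLG^2J^2H^2(4\delta^2+1)}{\varepsilon\sigma^2}+\tfrac{72L\sigma^2J^2}{\varepsilon^2b^{(0)}M}+\tfrac{12\sigma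 J\sqrt L}{\varepsilon\sqrt{Mb^{(0)}}}\sqrt{\tfrac{8b^{(0)}MLG^2J^2H^2(4\delta^2+1)}{\varepsilon\sigma^2}+\tfrac{36L\sigma^2J^2}{\varepsilon^2b^{(0)}M}};$$ 3. for all $M,H\ge1$ and all real $\delta\ge1$, $T(\delta,H)$ is a positive solution $T$ of $$\frac{12\sigma J\sqrt L}{\sqrt{MTb^{(0)}}}+(4\delta^2+1)\frac{8b^{(0)}MLG^2H^2J^2}{\sigma^2T}=\varepsilon,$$ and $K(\delta,H)\le C\,MH\delta^2+C\,\frac1{\sqrt M H}$. -/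

import Mathlib

open MeasureTheory ProbabilityTheory

namespace FTLSGD

noncomputable section

/-- The parameter space `ℝ^d` with its Euclidean norm. -/
abbrev Vec (d : ℕ) := EuclideanSpace ℝ (Fin d)

/-! ### The learning problem -/

/-- The data of a federated learning problem with `M` participants: participant `m` owns
`n m ≥ 1` samples, and `loss m i` is the loss of its `i`-th sample. -/
structure Problem (M d : ℕ) where
  n : Fin M → ℕ
  n_pos : ∀ m, 0 < n m
  loss : (m : Fin M) → Fin (n m) → Vec d → ℝ

namespace Problem

variable {M d : ℕ} (Q : Problem M d)

/-- The local objective `f_m`. -/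
def localLoss (m : Fin M) (w : Vec d) : ℝ :=
  (1 / (Q.n m : ℝ)) * ∑ i, Q.loss m i w

/-- The global objective `F`. -/
def globalLoss (w : Vec d) : ℝ :=
  (1 / (M : ℝ)) * ∑ m, Q.localLoss m w

/-- The optimal value `F*`. -/
def optValue : ℝ := ⨅ w, Q.globalLoss w

/-- The stochastic gradient of `f_m` at `w` over the mini-batch `B` of size `b`. -/
def batchGrad (m : Fin M) {b : ℕ} (B : Fin b → Fin (Q.n m)) (w : Vec d) : Vec d :=
  (1 / (b : ℝ)) • ∑ j, gradient (Q.loss m (B j)) w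

/-- The sample losses are differentiable and each `f_m` is `L`-smooth. -/
def IsSmooth (L : ℝ) : Prop :=
  (∀ m i, Differentiable ℝ (Q.loss m i)) ∧
  ∀ m w w', ‖gradient (Q.localLoss m) w - gradient (Q.localLoss m) w'‖ ≤ L * ‖w - w'‖

end Problem

/-- Mini-batches may be drawn with or without replacement. -/
inductive Sampling
  | withReplacement
  | withoutReplacement

/-- The equally likely mini-batches of size `b` from `n` samples.  (Without replacement the batch
is listed in a uniformly random order, which does not affect the stochastic gradient.) -/
def Sampling.batches (S : Sampling) (b n : ℕ) : Set (Fin b → Fin n) :=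
  match S with
  | .withReplacement => Set.univ
  | .withoutReplacement => {B | Function.Injective B}

namespace Problem

variable {M d : ℕ} (Q : Problem M d)

/-- Over a random mini-batch of size `b`, the variance of the stochastic gradient of every
participant is at most `σ ^ 2`, at every point. -/
def BoundedVariance (S : Sampling) (b : ℕ) (σ : ℝ) : Prop :=
  ∀ m w, ∫ B, ‖Q.batchGrad m B w - gradient (Q.localLoss m) w‖ ^ 2
    ∂(uniformOn (S.batches b (Q.n m))) ≤ σ ^ 2

/-- Over a random mini-batch of size `b`, the second moment of the stochastic gradient of every
participant is at most `G ^ 2`, at every point. -/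
def BoundedSecondMoment (S : Sampling) (b : ℕ) (G : ℝ) : Prop :=
  ∀ m w, ∫ B, ‖Q.batchGrad m B w‖ ^ 2 ∂(uniformOn (S.batches b (Q.n m))) ≤ G ^ 2

end Problem

/-! ### The algorithm -/

/-- The `k`-th largest absolute value of the entries of `x`, for `1 ≤ k ≤ d`: the largest `r` such
that at least `k` entries have absolute value at least `r`. -/
def kthLargestAbs {d : ℕ} (k : ℕ) (x : Vec d) : ℝ :=
  sSup {r : ℝ | k ≤ (Finset.univ.filter fun j => r ≤ |x j|).card}

/-- The compressor `Top_k`. -/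
def topK {d : ℕ} (k : ℕ) (x : Vec d) : Vec d :=
  WithLp.toLp 2 fun i => if kthLargestAbs k x ≤ |x i| then x i else 0

/-- Mini-batch size at iteration `t`. -/
def batchSize (ρ : ℝ) (b₀ t : ℕ) : ℕ := ⌊ρ ^ t * (b₀ : ℝ)⌋₊

/-- The global model `w`, the local models `ŵ_m` and the local errors `e_m`. -/
structure State (M d : ℕ) where
  w : Vec d
  what : Fin M → Vec d
  err : Fin M → Vec d

/-- Iteration `t` of the algorithm, when participant `m` uses the stochastic gradient `g m`. -/
def step {M d : ℕ} (H : ℕ) (k : Fin M → ℕ) (η : ℝ) (t : ℕ) (g : Fin M → Vec d)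
    (s : State M d) : State M d :=
  let half : Fin M → Vec d := fun m => s.what m - η • g m
  if H ∣ t + 1 then
    let u : Fin M → Vec d := fun m => s.err m + s.w - half m
    let w' : Vec d := s.w - (1 / (M : ℝ)) • ∑ m, topK (k m) (u m)
    { w := w', what := fun _ => w', err := fun m => u m - topK (k m) (u m) }
  else
    { w := s.w, what := half, err := s.err }

/-- The state at time `t`, for the initial model `w₀` and the mini-batches `B m t`. -/
def trajectory {M d : ℕ} (Q : Problem M d) (H : ℕ) (k : Fin M → ℕ) (η : ℝ) (b : ℕ → ℕ)
    (w₀ : Vec d) (B : (m : Fin M) → (t : ℕ) → Fin (b t) → Fin (Q.n m)) : ℕ → State M d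
  | 0 => { w := w₀, what := fun _ => w₀, err := fun _ => 0 }
  | t + 1 =>
    let s := trajectory Q H k η b w₀ B t
    step H k η t (fun m => Q.batchGrad m (B m t) (s.what m)) s

/-- The randomness of a run of `T` iterations: a random initial model, and mini-batches that are
uniformly distributed, mutually independent and independent of the initial model. -/
structure IsRandomRun {M d : ℕ} (Q : Problem M d) (S : Sampling) (T : ℕ) (b : ℕ → ℕ)
    {Ω : Type*} [MeasurableSpace Ω] (P : Measure Ω) (w₀ : Ω → Vec d)
    (B : (m : Fin M) → (t : ℕ) → Ω → Fin (b t) → Fin (Q.n m)) : Prop where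
  measurable_init : Measurable w₀
  measurable_batch : ∀ m, ∀ t < T, Measurable (B m t)
  law_batch : ∀ m, ∀ t < T, P.map (B m t) = uniformOn (S.batches (b t) (Q.n m))
  indep_batch : iIndepFun (fun (p : Fin M × Fin T) => B p.1 p.2) P
  indep_init : IndepFun w₀ (fun ω (p : Fin M × Fin T) => B p.1 p.2 ω) P

/-- `E ‖∇F(z_T)‖² ≤ ε`, where `z_T` is `ŵ_m^(t)` for an independent, uniformly random pair
`(m, t)` with `t < T`. -/
def ReachesAccuracy {M d : ℕ} (Q : Problem M d) (T : ℕ) {Ω : Type*} [MeasurableSpace Ω]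
    (P : Measure Ω) (X : Ω → ℕ → State M d) (ε : ℝ) : Prop :=
  let z : Ω × (Fin M × Fin T) → Vec d := fun q => (X q.1 q.2.2).what q.2.1
  let μ : Measure (Ω × (Fin M × Fin T)) := P.prod (uniformOn Set.univ)
  Integrable (fun q => ‖gradient Q.globalLoss (z q)‖ ^ 2) μ ∧
    ∫ q, ‖gradient Q.globalLoss (z q)‖ ^ 2 ∂μ ≤ ε

/-! ### Parameters and the explicit bound -/

/-- Root mean square `δ` of the sparsities `δ_m = d / k_m`. -/
def rmsSparsity {M : ℕ} (d : ℕ) (k : Fin M → ℕ) : ℝ :=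
  √((1 / (M : ℝ)) * ∑ m, ((d : ℝ) / (k m : ℝ)) ^ 2)

/-- The batch size factor `ρ = T / (T - 1)`. -/
def rho (T : ℕ) : ℝ := (T : ℝ) / ((T : ℝ) - 1)

/-- The learning rate `η = θ √M / √T` with `θ² = b₀ Δ / (σ² L)`. -/
def learningRate (σ L : ℝ) (b₀ M T : ℕ) (Δ : ℝ) : ℝ :=
  √((b₀ : ℝ) * Δ / (σ ^ 2 * L)) * √(M : ℝ) / √(T : ℝ)

/-- The bound on `E ‖∇F(z_T)‖²` after `T` iterations. -/
def errorBound (σ G L J : ℝ) (b₀ M H : ℕ) (δ T : ℝ) : ℝ :=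
  12 * σ * J * √L / √(M * T * b₀)
    + (4 * δ ^ 2 + 1) * (8 * b₀ * M * L * G ^ 2 * H ^ 2 * J ^ 2 / (σ ^ 2 * T))

/-- The number of iterations at which the bound equals `ε`. -/
def iterationBound (σ G L J ε : ℝ) (b₀ M H : ℕ) (δ : ℝ) : ℝ :=
  8 * b₀ * M * L * G ^ 2 * J ^ 2 * H ^ 2 * (4 * δ ^ 2 + 1) / (ε * σ ^ 2)
    + 72 * L * σ ^ 2 * J ^ 2 / (ε ^ 2 * b₀ * M)
    + 12 * σ * J * √L / (ε * √(M * b₀))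
      * √(8 * b₀ * M * L * G ^ 2 * J ^ 2 * H ^ 2 * (4 * δ ^ 2 + 1) / (ε * σ ^ 2)
          + 36 * L * σ ^ 2 * J ^ 2 / (ε ^ 2 * b₀ * M))

/-- The corresponding number of communication rounds, one every `H` iterations. -/
def roundBound (σ G L J ε : ℝ) (b₀ M H : ℕ) (δ : ℝ) : ℝ :=
  iterationBound σ G L J ε b₀ M H δ / H

end

end FTLSGD

open FTLSGD

/-! Compression does not affect the averaged dynamics. Let c_t be the average of ŵ_m − e_m
(`State.center`). Whatever `topK` discards is kept in e_m, so c_{t+1} = c_t − η · (mean stochastic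
gradient) at every iteration, synchronizing or not (`center_step`). This is SGD on F along c_t,
except that gradients are taken at ŵ_m; by smoothness that costs L² times the mean squared distance
`State.spread`.

The spread comes from local drift and stored errors. At most H steps of second moment G² separate
two synchronizations, so the drift is at most (HηG)² in mean square. `topK` removes a share k_m/d =
1/δ_m of the squared norm (`norm_sub_topK_sq_le`), so the errors obey a contracting recursion that
preserves the bound 4δ_m²(HηG)² (`integral_norm_err_sq_le`). The noise is independent across
participants, so averaging divides its variance V by M. Telescoping the descent inequality gives
`sum_integral_norm_gradient_sq_le`: initial gap, drift of order η² and noise of order ηV/M. The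
prescribed η turns this into `errorBound`, which decreases in T; in the unknown √T, `errorBound = ε`
is a quadratic equation whose positive root gives `iterationBound`.

If the variance bound holds for single samples, batches of size at least b₀ have variance at most
σ²/b₀ (`integral_norm_batchGrad_sub_sq_le`). Otherwise V = σ² loses a factor b₀, recovered by aiming
at accuracy ε/b₀ and enlarging C.

Descent needs Lη ≤ 1. If G² ≤ ε the claim is trivial, as ‖∇F‖ ≤ G everywhere; if ε < G², the lower
bound on T forces Lη ≤ 1. If the initial gap vanishes, then η = 0 and the initial model is almost
surely a minimizer. -/

namespace FTLSGD

/-! ### The compressor: selection rule, measurability, contraction. -/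

section TopK

variable {d : ℕ}

/-- Raising a threshold r to the smallest |x j| that is at least r does not change which entries
pass, so only the finitely many entry values compete. -/
theorem exists_isGreatest_abs {k : ℕ} (hk : 1 ≤ k) (hkd : k ≤ d) (x : Vec d) :
    ∃ j, IsGreatest {r : ℝ | k ≤ (Finset.univ.filter fun j => r ≤ |x j|).card} |x j| := by
  classical
  have key : ∀ r : ℝ, k ≤ (Finset.univ.filter fun j => r ≤ |x j|).card →
      ∃ j, k ≤ (Finset.univ.filter fun i => |x j| ≤ |x i|).card ∧ r ≤ |x j| := by
    intro r hr
    have hne : (Finset.univ.filter fun j => r ≤ |x j|).Nonempty :=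
      Finset.card_pos.mp (by omega)
    obtain ⟨j, hj, hmin⟩ := Finset.exists_min_image _ (fun i => |x i|) hne
    refine ⟨j, hr.trans (Finset.card_le_card fun i hi => ?_), (Finset.mem_filter.mp hj).2⟩
    exact Finset.mem_filter.mpr ⟨Finset.mem_univ _, hmin i hi⟩
  have h0 : k ≤ (Finset.univ.filter fun j => (0 : ℝ) ≤ |x j|).card := by
    simpa using hkd
  obtain ⟨j₁, hj₁, -⟩ := key 0 h0
  obtain ⟨j, hj, hmax⟩ := Finset.exists_max_image
    (Finset.univ.filter fun j => k ≤ (Finset.univ.filter fun i => |x j| ≤ |x i|).card)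
    (fun i => |x i|) ⟨j₁, by simpa using hj₁⟩
  refine ⟨j, (Finset.mem_filter.mp hj).2, fun r hr => ?_⟩
  obtain ⟨i, hi, hri⟩ := key r hr
  exact hri.trans (hmax i (by simpa using hi))

theorem isGreatest_kthLargestAbs {k : ℕ} (hk : 1 ≤ k) (hkd : k ≤ d) (x : Vec d) :
    IsGreatest {r : ℝ | k ≤ (Finset.univ.filter fun j => r ≤ |x j|).card}
      (kthLargestAbs k x) := by
  obtain ⟨j, hj⟩ := exists_isGreatest_abs hk hkd x
  rwa [kthLargestAbs, hj.csSup_eq]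

/-- Counting strictly larger entries replaces the supremum by finitely many comparisons, from which
measurability of `topK` is read off. -/
theorem kthLargestAbs_le_iff {k : ℕ} (hk : 1 ≤ k) (hkd : k ≤ d) (x : Vec d) (i : Fin d) :
    kthLargestAbs k x ≤ |x i| ↔ (Finset.univ.filter fun j => |x i| < |x j|).card < k := by
  have hg := isGreatest_kthLargestAbs hk hkd x
  constructor
  · intro h
    by_contra! hc
    obtain ⟨j, hj, hmin⟩ := Finset.exists_min_image _ (fun i => |x i|)
      (Finset.card_pos.mp (by omega : 0 < (Finset.univ.filter fun j => |x i| < |x j|).card))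
    have : |x j| ≤ kthLargestAbs k x := by
      refine hg.2 (hc.trans (Finset.card_le_card fun l hl => ?_))
      exact Finset.mem_filter.mpr ⟨Finset.mem_univ _, hmin l hl⟩
    linarith [(Finset.mem_filter.mp hj).2]
  · intro h
    by_contra! hc
    have h1 : k ≤ (Finset.univ.filter fun j => kthLargestAbs k x ≤ |x j|).card := hg.1
    refine absurd (h1.trans (Finset.card_le_card fun l hl => ?_)) (not_le.mpr h)
    exact Finset.mem_filter.mpr ⟨Finset.mem_univ _, hc.trans_le (Finset.mem_filter.mp hl).2⟩

theorem measurable_topK {k : ℕ} (hk : 1 ≤ k) (hkd : k ≤ d) :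
    Measurable (topK k : Vec d → Vec d) := by
  have hc : ∀ i, Measurable fun x : Vec d => x i := fun i => by fun_prop
  refine (WithLp.measurable_toLp 2 (Fin d → ℝ)).comp (measurable_pi_lambda _ fun i => ?_)
  refine Measurable.ite ?_ (hc i) measurable_const
  simp_rw [kthLargestAbs_le_iff hk hkd]
  have : Measurable fun x : Vec d => (Finset.univ.filter fun j => |x i| < |x j|).card := by
    simp_rw [Finset.card_filter]
    refine Finset.measurable_sum _ fun j _ => Measurable.ite ?_ measurable_const measurable_const
    exact measurableSet_lt (hc i).abs (hc j).abs
  exact measurableSet_lt this measurable_const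

/-- Every discarded square is at most r² and every kept one at least r², so the discarded entries
carry at most their proportional share of ‖x‖². Ties only increase the number kept beyond k. -/
theorem norm_sub_topK_sq_le {k : ℕ} (hk : 1 ≤ k) (hkd : k ≤ d) (x : Vec d) :
    ‖x - topK k x‖ ^ 2 ≤ (1 - (k : ℝ) / d) * ‖x‖ ^ 2 := by
  classical
  set r := kthLargestAbs k x with hr
  have hg := isGreatest_kthLargestAbs hk hkd x
  have hr0 : 0 ≤ r := hg.2 (by simpa using hkd)
  set S := Finset.univ.filter fun i => r ≤ |x i| with hS
  set N := Finset.univ.filter fun i => ¬ r ≤ |x i| with hN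
  have hkS : k ≤ S.card := hg.1
  have hcard : (S.card : ℝ) + N.card = d := by
    have := Finset.card_filter_add_card_filter_not (s := (Finset.univ : Finset (Fin d)))
      (fun i => r ≤ |x i|)
    rw [Finset.card_univ, Fintype.card_fin] at this
    exact_mod_cast this
  have hx : ‖x‖ ^ 2 = ∑ i ∈ S, x i ^ 2 + ∑ i ∈ N, x i ^ 2 := by
    rw [EuclideanSpace.real_norm_sq_eq, hS, hN, Finset.sum_filter_add_sum_filter_not]
  have hy : ‖x - topK k x‖ ^ 2 = ∑ i ∈ N, x i ^ 2 := by
    rw [EuclideanSpace.real_norm_sq_eq, hN, Finset.sum_filter]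
    refine Finset.sum_congr rfl fun i _ => ?_
    by_cases h : r ≤ |x i|
    · simp [topK, ← hr, h]
    · simp [topK, ← hr, h]
  have hN' : ∑ i ∈ N, x i ^ 2 ≤ N.card * r ^ 2 := by
    rw [← nsmul_eq_mul]
    refine Finset.sum_le_card_nsmul _ _ _ fun i hi => ?_
    have := (Finset.mem_filter.mp hi).2
    rw [← sq_abs (x i)]
    exact pow_le_pow_left₀ (abs_nonneg _) (not_le.mp this).le 2
  have hS' : S.card * r ^ 2 ≤ ∑ i ∈ S, x i ^ 2 := by
    rw [← nsmul_eq_mul]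
    refine Finset.card_nsmul_le_sum _ _ _ fun i hi => ?_
    have := (Finset.mem_filter.mp hi).2
    rw [← sq_abs (x i)]
    exact pow_le_pow_left₀ hr0 this 2
  have hd : (0 : ℝ) < d := by exact_mod_cast (by omega : 0 < d)
  have hk' : (k : ℝ) ≤ S.card := by exact_mod_cast hkS
  rw [hy, hx]
  set a := ∑ i ∈ S, x i ^ 2
  set b := ∑ i ∈ N, x i ^ 2
  have hb0 : 0 ≤ b := Finset.sum_nonneg fun _ _ => sq_nonneg _
  have ha0 : 0 ≤ a := Finset.sum_nonneg fun _ _ => sq_nonneg _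
  have h1 : b * S.card ≤ N.card * a := by
    calc b * S.card ≤ (N.card * r ^ 2) * S.card := by gcongr
      _ = N.card * (S.card * r ^ 2) := by ring
      _ ≤ N.card * a := by gcongr
  have h2 : b * d ≤ (d - k) * (a + b) := by
    have : (k : ℝ) * (a + b) ≤ S.card * (a + b) := by gcongr
    have h3 : (N.card : ℝ) = d - S.card := by linarith
    rw [h3] at h1
    nlinarith
  have h4 : (1 - (k : ℝ) / d) * (a + b) = ((d - k) * (a + b)) / d := by field_simp
  rw [h4, le_div_iff₀ hd]
  exact h2

end TopK

/-! ### Smooth functions and gradients of averages. -/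

section Smooth

variable {E : Type*} [NormedAddCommGroup E] [InnerProductSpace ℝ E] [CompleteSpace E]

theorem le_quadratic_of_lipschitz_gradient {f : E → ℝ} {L : ℝ} (hf : Differentiable ℝ f)
    (hL : ∀ x y, ‖gradient f x - gradient f y‖ ≤ L * ‖x - y‖) (x v : E) :
    f (x + v) ≤ f x + inner ℝ (gradient f x) v + L / 2 * ‖v‖ ^ 2 := by
  -- The gap to the quadratic upper model along the segment; its derivative is nonpositive on (0, 1)
  -- by Cauchy–Schwarz and the Lipschitz bound.
  let φ : ℝ → ℝ := fun s => f (x + s • v) - s * inner ℝ (gradient f x) v - L / 2 * s ^ 2 * ‖v‖ ^ 2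
  have hd : ∀ s, HasDerivAt φ (inner ℝ (gradient f (x + s • v)) v - inner ℝ (gradient f x) v
      - L * s * ‖v‖ ^ 2) s := by
    intro s
    have h1 : HasDerivAt (fun s : ℝ => x + s • v) v s := by
      simpa using ((hasDerivAt_id s).smul_const v).const_add x
    have h2 := ((hf (x + s • v)).hasFDerivAt).comp_hasDerivAt s h1
    rw [← inner_gradient_left] at h2
    have h3 : HasDerivAt (fun s : ℝ => s * inner ℝ (gradient f x) v)
        (inner ℝ (gradient f x) v) s := by
      simpa using (hasDerivAt_id s).mul_const (inner ℝ (gradient f x) v)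
    have h4 : HasDerivAt (fun s : ℝ => L / 2 * s ^ 2 * ‖v‖ ^ 2) (L * s * ‖v‖ ^ 2) s := by
      have := ((hasDerivAt_pow 2 s).const_mul (L / 2)).mul_const (‖v‖ ^ 2)
      exact this.congr_deriv (by push_cast; ring)
    exact (h2.sub h3).sub h4
  have hanti : AntitoneOn φ (Set.Icc 0 1) := by
    refine antitoneOn_of_deriv_nonpos (convex_Icc 0 1)
      (fun s _ => (hd s).continuousAt.continuousWithinAt)
      (fun s _ => (hd s).differentiableAt.differentiableWithinAt) fun s hs => ?_
    rw [interior_Icc] at hs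
    rw [(hd s).deriv, ← inner_sub_left]
    have h1 := real_inner_le_norm (gradient f (x + s • v) - gradient f x) v
    have h2 := hL (x + s • v) x
    rw [add_sub_cancel_left, norm_smul, Real.norm_of_nonneg hs.1.le] at h2
    nlinarith [mul_le_mul_of_nonneg_right h2 (norm_nonneg v)]
  have := hanti (Set.left_mem_Icc.mpr zero_le_one) (Set.right_mem_Icc.mpr zero_le_one) zero_le_one
  simp only [φ, one_smul, zero_smul, add_zero, one_pow] at this
  linarith

theorem gradient_const_mul_sum {ι : Type*} [Fintype ι] {f : ι → E → ℝ} (c : ℝ)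
    (hf : ∀ i, Differentiable ℝ (f i)) (x : E) :
    gradient (fun w => c * ∑ i, f i w) x = c • ∑ i, gradient (f i) x := by
  apply HasGradientAt.gradient
  rw [hasGradientAt_iff_hasFDerivAt]
  have h := (HasFDerivAt.fun_sum (u := Finset.univ)
    fun i _ => ((hf i x).hasGradientAt.hasFDerivAt)).const_mul c
  refine h.congr_fderiv ?_
  ext v
  simp

end Smooth

/-! ### Inequalities for means and squared norms. -/

section Mean

variable {E : Type*} [NormedAddCommGroup E] [InnerProductSpace ℝ E]

/-- The mean of squared distances to the mean is at most that to any other point. -/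
theorem sum_norm_sub_mean_sq_le {ι : Type*} [Fintype ι] [Nonempty ι] (y : ι → E) (c : E) :
    ∑ i, ‖y i - (1 / (Fintype.card ι : ℝ)) • ∑ j, y j‖ ^ 2 ≤ ∑ i, ‖y i - c‖ ^ 2 := by
  set a := (1 / (Fintype.card ι : ℝ)) • ∑ j, y j with ha
  have hcard : (0 : ℝ) < Fintype.card ι := by exact_mod_cast Fintype.card_pos
  have h0 : ∑ i, (y i - a) = 0 := by
    rw [Finset.sum_sub_distrib, Finset.sum_const, Finset.card_univ, ← Nat.cast_smul_eq_nsmul ℝ, ha,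
      smul_smul]
    field_simp
    simp
  have h1 : ∀ i, ‖y i - c‖ ^ 2 = ‖y i - a‖ ^ 2 + 2 * inner ℝ (y i - a) (a - c) + ‖a - c‖ ^ 2 := by
    intro i
    rw [← norm_add_sq_real]; congr 2; abel
  simp_rw [h1]
  rw [Finset.sum_add_distrib, Finset.sum_add_distrib, ← Finset.mul_sum, ← sum_inner, h0]
  simp
  positivity

theorem norm_mean_sq_le {ι : Type*} [Fintype ι] (y : ι → E) :
    ‖(1 / (Fintype.card ι : ℝ)) • ∑ j, y j‖ ^ 2 ≤ (1 / (Fintype.card ι : ℝ)) * ∑ i, ‖y i‖ ^ 2 := by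
  rcases isEmpty_or_nonempty ι with h | h
  · simp
  have hcard : (0 : ℝ) < Fintype.card ι := by exact_mod_cast Fintype.card_pos
  have h1 : ‖∑ j, y j‖ ^ 2 ≤ Fintype.card ι * ∑ i, ‖y i‖ ^ 2 :=
    (pow_le_pow_left₀ (norm_nonneg _) (norm_sum_le _ _) 2).trans
      (by simpa using sq_sum_le_card_mul_sum_sq (s := Finset.univ) (f := fun i => ‖y i‖))
  rw [norm_smul, mul_pow, Real.norm_of_nonneg (by positivity)]
  calc (1 / (Fintype.card ι : ℝ)) ^ 2 * ‖∑ j, y j‖ ^ 2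
      ≤ (1 / (Fintype.card ι : ℝ)) ^ 2 * (Fintype.card ι * ∑ i, ‖y i‖ ^ 2) := by gcongr
    _ = _ := by field_simp

theorem norm_add_sq_le_young {E : Type*} [NormedAddCommGroup E] (x y : E) {a : ℝ} (ha : 0 < a) :
    ‖x + y‖ ^ 2 ≤ (1 + a) * ‖x‖ ^ 2 + (1 + a⁻¹) * ‖y‖ ^ 2 := by
  have h1 : ‖x + y‖ ^ 2 ≤ (‖x‖ + ‖y‖) ^ 2 := pow_le_pow_left₀ (norm_nonneg _) (norm_add_le _ _) 2
  have h2 : 0 ≤ a⁻¹ * (a * ‖x‖ - ‖y‖) ^ 2 := by positivity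
  have h3 : a⁻¹ * (a * ‖x‖ - ‖y‖) ^ 2 = a * ‖x‖ ^ 2 - 2 * ‖x‖ * ‖y‖ + a⁻¹ * ‖y‖ ^ 2 := by
    field_simp; ring
  nlinarith

end Mean

/-! ### Conditioning by redrawing coordinates of a product measure. -/

section Resample

variable {ι : Type*} [Fintype ι] {α : ι → Type*} [∀ i, MeasurableSpace (α i)]
  (μ : ∀ i, Measure (α i)) [∀ i, IsProbabilityMeasure (μ i)] (p : ι → Prop) [DecidablePred p]

/-- Replacing the coordinates in `p` by an independent copy preserves the product law. With Fubini
this plays the role of conditioning on the remaining coordinates. -/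
theorem measurePreserving_resample :
    MeasurePreserving (fun (q : (∀ i, α i) × (∀ i, α i)) i => if p i then q.2 i else q.1 i)
      ((Measure.pi μ).prod (Measure.pi μ)) (Measure.pi μ) := by
  have hm : Measurable
      (fun (q : (∀ i, α i) × (∀ i, α i)) i => if p i then q.2 i else q.1 i) := by
    refine measurable_pi_lambda _ fun i => ?_
    by_cases h : p i
    · simp only [h, if_true]; fun_prop
    · simp only [h, if_false]; fun_prop
  refine ⟨hm, (Measure.pi_eq fun s hs => ?_).symm⟩
  rw [Measure.map_apply hm (MeasurableSet.univ_pi hs)]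
  have hset : (fun (q : (∀ i, α i) × (∀ i, α i)) i => if p i then q.2 i else q.1 i) ⁻¹'
      (Set.pi Set.univ s) = (Set.pi Set.univ fun i => if p i then Set.univ else s i) ×ˢ
        (Set.pi Set.univ fun i => if p i then s i else Set.univ) := by
    ext q
    simp only [Set.mem_preimage, Set.mem_pi, Set.mem_univ, true_implies, Set.mem_prod]
    rw [← forall_and]
    refine forall_congr' fun i => ?_
    by_cases h : p i <;> simp [h]
  rw [hset, Measure.prod_prod, Measure.pi_pi, Measure.pi_pi, ← Finset.prod_mul_distrib]
  refine Finset.prod_congr rfl fun i _ => ?_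
  by_cases h : p i <;> simp [h]

theorem integral_resample [∀ i, Finite (α i)] [∀ i, MeasurableSingletonClass (α i)]
    {E : Type*} [NormedAddCommGroup E] [NormedSpace ℝ E] (φ : (∀ i, α i) → E) :
    ∫ β, φ β ∂(Measure.pi μ)
      = ∫ β, ∫ γ, φ (fun i => if p i then γ i else β i) ∂(Measure.pi μ) ∂(Measure.pi μ) := by
  have h := measurePreserving_resample μ p
  rw [← h.map_eq, integral_map h.measurable.aemeasurable Integrable.of_finite.aestronglyMeasurable, h.map_eq]
  exact integral_prod _ Integrable.of_finite

/-- Functions of distinct coordinates, one of them centered, are uncorrelated. -/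
theorem integral_inner_eq_zero [∀ i, Finite (α i)] [∀ i, MeasurableSingletonClass (α i)]
    {E : Type*} [NormedAddCommGroup E] [InnerProductSpace ℝ E] [CompleteSpace E] [DecidableEq ι]
    {i j : ι} (hij : i ≠ j) (f : α i → E) (g : α j → E) (hf : ∫ x, f x ∂(μ i) = 0) :
    ∫ β, inner ℝ (f (β i)) (g (β j)) ∂(Measure.pi μ) = 0 := by
  -- Only coordinate `i` is redrawn, so `g (β j)` is constant in the inner integral.
  rw [integral_resample μ (· = i)]
  simp only [if_true, hij.symm, if_false]
  have : ∀ β : ∀ i, α i, ∫ γ, inner ℝ (f (γ i)) (g (β j)) ∂(Measure.pi μ) = 0 := by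
    intro β
    simp_rw [real_inner_comm]
    rw [integral_inner Integrable.of_finite, integral_comp_eval, hf, inner_zero_right]
    exact Integrable.of_finite.aestronglyMeasurable
  simp [this]

end Resample

/-! ### Mini-batch sampling: uniform marginals and nonpositive correlations. -/

section Batches

theorem integral_uniformOn {α : Type*} [Fintype α] [MeasurableSpace α]
    [MeasurableSingletonClass α] {E : Type*} [NormedAddCommGroup E] [NormedSpace ℝ E]
    [CompleteSpace E] (A : Finset α) (f : α → E) :
    ∫ x, f x ∂(uniformOn (A : Set α)) = (A.card : ℝ)⁻¹ • ∑ x ∈ A, f x := by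
  rw [uniformOn, ProbabilityTheory.cond, integral_smul_measure, Measure.count_apply_finset,
    ENNReal.toReal_inv, ENNReal.toReal_natCast]
  congr 1
  rw [setIntegral_finset A Integrable.of_finite.integrableOn]
  simp

open Classical in
/-- The mini-batches as a finset. -/
noncomputable def batchFinset (S : Sampling) (b n : ℕ) : Finset (Fin b → Fin n) :=
  Finset.univ.filter (· ∈ S.batches b n)

theorem coe_batchFinset (S : Sampling) (b n : ℕ) :
    (batchFinset S b n : Set (Fin b → Fin n)) = S.batches b n := by
  ext; simp [batchFinset]

theorem mem_batchFinset_withoutReplacement {b n : ℕ} {B : Fin b → Fin n} :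
    B ∈ batchFinset .withoutReplacement b n ↔ Function.Injective B := by
  simp only [batchFinset, Finset.mem_filter, Finset.mem_univ, true_and]
  rfl

/-- Relabelling the samples is a symmetry of both sampling schemes, so sums over batches can be
averaged over all permutations. -/
theorem mem_batchFinset_comp (S : Sampling) {b n : ℕ} (π : Equiv.Perm (Fin n))
    (B : Fin b → Fin n) : B ∈ batchFinset S b n ↔ π ∘ B ∈ batchFinset S b n := by
  cases S
  · simp [batchFinset, Sampling.batches]
  · rw [mem_batchFinset_withoutReplacement, mem_batchFinset_withoutReplacement,
      π.injective.of_comp_iff]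

variable {E : Type*} [NormedAddCommGroup E] {n b : ℕ}

theorem sum_batchFinset_comp [NormedSpace ℝ E] (S : Sampling) (π : Equiv.Perm (Fin n))
    (f : (Fin b → Fin n) → E) :
    ∑ B ∈ batchFinset S b n, f (π ∘ B) = ∑ B ∈ batchFinset S b n, f B :=
  Finset.sum_equiv ((Equiv.refl (Fin b)).arrowCongr π) (fun B => mem_batchFinset_comp S π B)
    fun _ _ => rfl

/-- Composing with a transposition shows that the sum over π does not depend on `x`; summing over
all points and exchanging the sums evaluates it. -/
theorem sum_perm_apply [NormedSpace ℝ E] (h : Fin n → E) (x : Fin n) :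
    (n : ℝ) • ∑ π : Equiv.Perm (Fin n), h (π x) = (n.factorial : ℝ) • ∑ i, h i := by
  have hc : ∀ y, ∑ π : Equiv.Perm (Fin n), h (π y) = ∑ π : Equiv.Perm (Fin n), h (π x) := by
    intro y
    refine Finset.sum_equiv (Equiv.mulRight (Equiv.swap x y)) (by simp) fun π _ => ?_
    simp
  calc (n : ℝ) • ∑ π : Equiv.Perm (Fin n), h (π x)
      = ∑ y : Fin n, ∑ π : Equiv.Perm (Fin n), h (π y) := by
        simp [hc, ← Nat.cast_smul_eq_nsmul ℝ]
    _ = ∑ π : Equiv.Perm (Fin n), ∑ y, h (π y) := Finset.sum_comm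
    _ = ∑ π : Equiv.Perm (Fin n), ∑ y, h y :=
        Finset.sum_congr rfl fun π _ => Equiv.sum_comp π h
    _ = _ := by simp [Fintype.card_perm, ← Nat.cast_smul_eq_nsmul ℝ]

/-- Every entry of a random mini-batch is uniformly distributed. -/
theorem sum_batchFinset_apply [NormedSpace ℝ E] (S : Sampling) (h : Fin n → E) (j : Fin b) :
    (n : ℝ) • ∑ B ∈ batchFinset S b n, h (B j)
      = ((batchFinset S b n).card : ℝ) • ∑ i, h i := by
  have hf : (n.factorial : ℝ) ≠ 0 := by positivity
  have h1 : (n.factorial : ℝ) • ∑ B ∈ batchFinset S b n, h (B j)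
      = ∑ B ∈ batchFinset S b n, ∑ π : Equiv.Perm (Fin n), h (π (B j)) := by
    rw [Finset.sum_comm]
    have : ∀ π : Equiv.Perm (Fin n), ∑ B ∈ batchFinset S b n, h (π (B j))
        = ∑ B ∈ batchFinset S b n, h (B j) :=
      fun π => sum_batchFinset_comp S π fun B => h (B j)
    simp [this, Fintype.card_perm, ← Nat.cast_smul_eq_nsmul ℝ]
  apply smul_right_injective E hf
  simp only
  rw [smul_comm, h1, Finset.smul_sum]
  simp_rw [sum_perm_apply]
  rw [Finset.sum_const, ← Nat.cast_smul_eq_nsmul ℝ, smul_comm]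

variable [InnerProductSpace ℝ E]

/-- Since `a` sums to zero, the terms over all z add up to zero. The term z = x is nonnegative and
the others are all equal, hence nonpositive. -/
theorem sum_perm_inner_nonpos (a : Fin n → E) (ha : ∑ i, a i = 0) {x y : Fin n} (hxy : x ≠ y) :
    ∑ π : Equiv.Perm (Fin n), inner ℝ (a (π x)) (a (π y)) ≤ 0 := by
  have hc : ∀ z, z ≠ x → ∑ π : Equiv.Perm (Fin n), inner ℝ (a (π x)) (a (π z))
      = ∑ π : Equiv.Perm (Fin n), inner ℝ (a (π x)) (a (π y)) := by
    intro z hz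
    refine Finset.sum_equiv (Equiv.mulRight (Equiv.swap y z)) (by simp) fun π _ => ?_
    simp [Equiv.swap_apply_of_ne_of_ne hxy hz.symm]
  have h0 : ∑ z, ∑ π : Equiv.Perm (Fin n), inner ℝ (a (π x)) (a (π z)) = 0 := by
    rw [Finset.sum_comm]
    refine Finset.sum_eq_zero fun π _ => ?_
    rw [← inner_sum, Equiv.sum_comp π a, ha, inner_zero_right]
  rw [← Finset.add_sum_erase _ _ (Finset.mem_univ x),
    Finset.sum_congr rfl fun z hz => hc z (Finset.ne_of_mem_erase hz), Finset.sum_const,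
    nsmul_eq_mul] at h0
  have h1 : 0 ≤ ∑ π : Equiv.Perm (Fin n), inner ℝ (a (π x)) (a (π x)) :=
    Finset.sum_nonneg fun _ _ => real_inner_self_nonneg
  have h2 : (0 : ℝ) < (Finset.univ.erase x).card := by
    exact_mod_cast Finset.card_pos.mpr ⟨y, Finset.mem_erase.mpr ⟨hxy.symm, Finset.mem_univ _⟩⟩
  by_contra! h
  have := mul_pos h2 h
  linarith

/-- Distinct entries of a random mini-batch are not positively correlated. -/
theorem sum_batchFinset_inner_nonpos (S : Sampling) (a : Fin n → E) (ha : ∑ i, a i = 0)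
    {i j : Fin b} (hij : i ≠ j) :
    ∑ B ∈ batchFinset S b n, inner ℝ (a (B i)) (a (B j)) ≤ 0 := by
  have hf : (0 : ℝ) < n.factorial := by positivity
  refine nonpos_of_mul_nonpos_right (a := (n.factorial : ℝ)) ?_ hf
  cases S with
  | withReplacement =>
    refine le_of_eq ?_
    -- With replacement, entry `i` alone may be relabelled; averaging over π then replaces `a (B i)`
    -- by the mean of `a`, which is zero.
    have h1 : ∀ π : Equiv.Perm (Fin n),
        ∑ B ∈ batchFinset .withReplacement b n, inner ℝ (a (B i)) (a (B j))
          = ∑ B ∈ batchFinset .withReplacement b n, inner ℝ (a (π (B i))) (a (B j)) := by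
      intro π
      refine (Finset.sum_equiv (Equiv.piCongrRight fun k : Fin b => if k = i then π else 1)
        (by simp [batchFinset, Sampling.batches]) fun B _ => ?_).symm
      simp [hij.symm]
    have h2 : (n.factorial : ℝ)
        * ∑ B ∈ batchFinset .withReplacement b n, inner ℝ (a (B i)) (a (B j))
        = ∑ π : Equiv.Perm (Fin n),
          ∑ B ∈ batchFinset .withReplacement b n, inner ℝ (a (π (B i))) (a (B j)) := by
      rw [← Finset.sum_congr rfl fun π _ => h1 π]
      simp [Fintype.card_perm]
    rw [h2, Finset.sum_comm]
    refine Finset.sum_eq_zero fun B _ => ?_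
    have hn : (n : ℝ) ≠ 0 := by
      have := (B i).pos; positivity
    have h3 := sum_perm_apply a (B i)
    rw [ha, smul_zero] at h3
    rw [← sum_inner, (smul_eq_zero.mp h3).resolve_left hn, inner_zero_left]
  | withoutReplacement =>
    have h2 : (n.factorial : ℝ)
        * ∑ B ∈ batchFinset .withoutReplacement b n, inner ℝ (a (B i)) (a (B j))
        = ∑ π : Equiv.Perm (Fin n),
          ∑ B ∈ batchFinset .withoutReplacement b n, inner ℝ (a (π (B i))) (a (π (B j))) := by
      have : ∀ π : Equiv.Perm (Fin n),
          ∑ B ∈ batchFinset .withoutReplacement b n, inner ℝ (a (π (B i))) (a (π (B j)))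
          = ∑ B ∈ batchFinset .withoutReplacement b n, inner ℝ (a (B i)) (a (B j)) :=
        fun π => sum_batchFinset_comp _ π fun B => (inner ℝ (a (B i)) (a (B j)) : ℝ)
      simp [this, Fintype.card_perm]
    rw [h2, Finset.sum_comm]
    refine Finset.sum_nonpos fun B hB => sum_perm_inner_nonpos a ha ?_
    exact (mem_batchFinset_withoutReplacement.mp hB).ne hij

theorem sum_batchFinset_norm_sum_sq_le (S : Sampling) (a : Fin n → E) (ha : ∑ i, a i = 0) :
    (n : ℝ) * ∑ B ∈ batchFinset S b n, ‖∑ j, a (B j)‖ ^ 2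
      ≤ b * ((batchFinset S b n).card * ∑ i, ‖a i‖ ^ 2) := by
  have h1 : ∑ B ∈ batchFinset S b n, ‖∑ j, a (B j)‖ ^ 2
      = ∑ i, ∑ j, ∑ B ∈ batchFinset S b n, inner ℝ (a (B i)) (a (B j)) := by
    simp_rw [← real_inner_self_eq_norm_sq, sum_inner, inner_sum]
    rw [Finset.sum_comm]
    exact Finset.sum_congr rfl fun i _ => Finset.sum_comm
  have h2 : ∀ i : Fin b, ∑ j, ∑ B ∈ batchFinset S b n, inner ℝ (a (B i)) (a (B j))
      ≤ ∑ B ∈ batchFinset S b n, ‖a (B i)‖ ^ 2 := by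
    intro i
    rw [← Finset.add_sum_erase _ _ (Finset.mem_univ i)]
    simp_rw [real_inner_self_eq_norm_sq]
    have := Finset.sum_nonpos fun j hj =>
      sum_batchFinset_inner_nonpos S a ha (Finset.ne_of_mem_erase (s := Finset.univ) (a := i)
        (b := j) hj).symm
    linarith
  rw [h1]
  calc _ ≤ (n : ℝ) * ∑ i : Fin b, ∑ B ∈ batchFinset S b n, ‖a (B i)‖ ^ 2 := by
        gcongr with i; exact h2 i
    _ = ∑ i : Fin b, (n : ℝ) * ∑ B ∈ batchFinset S b n, ‖a (B i)‖ ^ 2 := Finset.mul_sum _ _ _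
    _ = ∑ i : Fin b, (batchFinset S b n).card * ∑ i, ‖a i‖ ^ 2 :=
        Finset.sum_congr rfl fun i _ => sum_batchFinset_apply S (fun x => ‖a x‖ ^ 2) i
    _ = _ := by simp

end Batches

/-! ### Mean and variance of mini-batch gradients. -/

section BatchGradient

variable {M d : ℕ} (Q : Problem M d) {S : Sampling} {b : ℕ}

/-- Without replacement there are no batches when b > n, and `uniformOn` is then the zero measure;
being a probability measure excludes this. -/
theorem card_batchFinset_pos {n : ℕ} [IsProbabilityMeasure (uniformOn (S.batches b n))] :
    (0 : ℝ) < (batchFinset S b n).card := by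
  have h : S.batches b n ≠ ∅ := fun h => by
    have := IsProbabilityMeasure.ne_zero (uniformOn (S.batches b n))
    exact this (by rw [h, uniformOn_empty_meas])
  rw [← coe_batchFinset] at h
  exact_mod_cast Finset.card_pos.mpr (Finset.coe_nonempty.mp (Set.nonempty_iff_ne_empty.mpr h))

theorem gradient_localLoss (hQ : ∀ m i, Differentiable ℝ (Q.loss m i)) (m : Fin M) (w : Vec d) :
    gradient (Q.localLoss m) w = (1 / (Q.n m : ℝ)) • ∑ i, gradient (Q.loss m i) w :=
  gradient_const_mul_sum _ (hQ m) w

theorem integral_batchGrad (hQ : ∀ m i, Differentiable ℝ (Q.loss m i)) (hb : 1 ≤ b) (m : Fin M)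
    [IsProbabilityMeasure (uniformOn (S.batches b (Q.n m)))] (w : Vec d) :
    ∫ B, Q.batchGrad m B w ∂(uniformOn (S.batches b (Q.n m))) = gradient (Q.localLoss m) w := by
  have hn : (Q.n m : ℝ) ≠ 0 := by have := Q.n_pos m; positivity
  have hb' : (b : ℝ) ≠ 0 := by positivity
  have hc := card_batchFinset_pos (S := S) (b := b) (n := Q.n m)
  rw [gradient_localLoss Q hQ, ← coe_batchFinset, integral_uniformOn]
  simp only [Problem.batchGrad]
  rw [← Finset.smul_sum, Finset.sum_comm]
  have h1 : ∀ j : Fin b, ∑ B ∈ batchFinset S b (Q.n m), gradient (Q.loss m (B j)) w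
      = ((batchFinset S b (Q.n m)).card / (Q.n m : ℝ)) • ∑ i, gradient (Q.loss m i) w := by
    intro j
    have := sum_batchFinset_apply S (fun i => gradient (Q.loss m i) w) j
    rw [div_eq_inv_mul, mul_smul, ← this, smul_smul, inv_mul_cancel₀ hn, one_smul]
  simp_rw [h1]
  rw [Finset.sum_const, Finset.card_univ, Fintype.card_fin, ← Nat.cast_smul_eq_nsmul ℝ]
  simp_rw [smul_smul]
  congr 1
  field_simp

theorem integral_norm_batchGrad_sub_sq_le (hQ : ∀ m i, Differentiable ℝ (Q.loss m i))
    (hb : 1 ≤ b) (m : Fin M) [IsProbabilityMeasure (uniformOn (S.batches b (Q.n m)))] {σ : ℝ}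
    (hσ : Q.BoundedVariance S 1 σ) (w : Vec d) :
    ∫ B, ‖Q.batchGrad m B w - gradient (Q.localLoss m) w‖ ^ 2
      ∂(uniformOn (S.batches b (Q.n m))) ≤ σ ^ 2 / b := by
  have hn : (0 : ℝ) < Q.n m := by exact_mod_cast Q.n_pos m
  have hb' : (0 : ℝ) < b := by exact_mod_cast hb
  set a : Fin (Q.n m) → Vec d := fun i => gradient (Q.loss m i) w - gradient (Q.localLoss m) w
    with ha
  have ha0 : ∑ i, a i = 0 := by
    rw [ha, Finset.sum_sub_distrib, gradient_localLoss Q hQ, Finset.sum_const, Finset.card_univ,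
      Fintype.card_fin, ← Nat.cast_smul_eq_nsmul ℝ, smul_smul, mul_one_div_cancel hn.ne', one_smul,
      sub_self]
  have hnorm : ∀ {b : ℕ}, 1 ≤ b → ∀ B : Fin b → Fin (Q.n m),
      ‖Q.batchGrad m B w - gradient (Q.localLoss m) w‖ ^ 2
        = (1 / (b : ℝ)) ^ 2 * ‖∑ j, a (B j)‖ ^ 2 := by
    intro b hb B
    have hb' : (0 : ℝ) < b := by exact_mod_cast hb
    have : Q.batchGrad m B w - gradient (Q.localLoss m) w = (1 / (b : ℝ)) • ∑ j, a (B j) := by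
      rw [ha, Finset.sum_sub_distrib, Finset.sum_const, Finset.card_univ, Fintype.card_fin,
        ← Nat.cast_smul_eq_nsmul ℝ, smul_sub, smul_smul, one_div_mul_cancel hb'.ne', one_smul]
      rfl
    rw [this, norm_smul, mul_pow, Real.norm_of_nonneg (by positivity)]
  have h1 := hσ m w
  have hc1 : (0 : ℝ) < (batchFinset S 1 (Q.n m)).card := by
    have : (fun _ => ⟨0, Q.n_pos m⟩) ∈ batchFinset S 1 (Q.n m) := by
      cases S
      · simp [batchFinset, Sampling.batches]
      · exact mem_batchFinset_withoutReplacement.mpr (Function.injective_of_subsingleton _)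
    exact_mod_cast Finset.card_pos.mpr ⟨_, this⟩
  have hc := card_batchFinset_pos (S := S) (b := b) (n := Q.n m)
  rw [← coe_batchFinset, integral_uniformOn] at h1 ⊢
  simp_rw [hnorm le_rfl] at h1
  simp_rw [hnorm hb]
  have h2 := sum_batchFinset_apply S (fun x => ‖a x‖ ^ 2) (0 : Fin 1)
  simp only [smul_eq_mul, Nat.cast_one, Fin.sum_univ_one, one_div, inv_one, one_pow, one_mul]
    at h1 h2
  -- A batch of size one is a uniform sample under either scheme, so `hσ` bounds the population
  -- variance.
  have h3 : ∑ i, ‖a i‖ ^ 2 ≤ Q.n m * σ ^ 2 := by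
    have h4 : (batchFinset S 1 (Q.n m)).card * ∑ i, ‖a i‖ ^ 2
        ≤ (batchFinset S 1 (Q.n m)).card * (Q.n m * σ ^ 2) := by
      rw [← h2]
      rw [inv_mul_le_iff₀ hc1] at h1
      nlinarith
    exact le_of_mul_le_mul_left h4 hc1
  have h5 := sum_batchFinset_norm_sum_sq_le (b := b) S a ha0
  rw [← Finset.mul_sum, smul_eq_mul, inv_mul_le_iff₀ hc, one_div, inv_pow,
    inv_mul_le_iff₀ (by positivity)]
  refine le_of_mul_le_mul_left (h5.trans ?_) hn
  calc _ ≤ (b : ℝ) * ((batchFinset S b (Q.n m)).card * (Q.n m * σ ^ 2)) := by gcongr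
    _ = _ := by field_simp

end BatchGradient

/-! ### Smoothness of the global objective. -/

section GlobalLoss

variable {M d : ℕ} {Q : Problem M d} {L : ℝ}

theorem differentiable_localLoss (hQ : Q.IsSmooth L) (m : Fin M) :
    Differentiable ℝ (Q.localLoss m) := by
  have : Q.localLoss m = fun w => (1 / (Q.n m : ℝ)) * ∑ i, Q.loss m i w := rfl
  rw [this]
  exact (Differentiable.fun_sum fun i _ => hQ.1 m i).const_mul _

theorem differentiable_globalLoss (hQ : Q.IsSmooth L) : Differentiable ℝ Q.globalLoss := by
  have : Q.globalLoss = fun w => (1 / (M : ℝ)) * ∑ m, Q.localLoss m w := rfl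
  rw [this]
  exact (Differentiable.fun_sum fun m _ => differentiable_localLoss hQ m).const_mul _

theorem gradient_globalLoss (hQ : Q.IsSmooth L) (w : Vec d) :
    gradient Q.globalLoss w = (1 / (M : ℝ)) • ∑ m, gradient (Q.localLoss m) w :=
  gradient_const_mul_sum _ (differentiable_localLoss hQ) w

theorem norm_gradient_globalLoss_sub_mean_sq_le (hQ : Q.IsSmooth L) (w : Vec d)
    (v : Fin M → Vec d) :
    ‖gradient Q.globalLoss w - (1 / (M : ℝ)) • ∑ m, gradient (Q.localLoss m) (v m)‖ ^ 2
      ≤ L ^ 2 * ((1 / (M : ℝ)) * ∑ m, ‖v m - w‖ ^ 2) := by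
  rw [gradient_globalLoss hQ, ← smul_sub, ← Finset.sum_sub_distrib]
  have h := norm_mean_sq_le fun m => gradient (Q.localLoss m) w - gradient (Q.localLoss m) (v m)
  rw [Fintype.card_fin] at h
  refine h.trans ?_
  rw [mul_left_comm (L ^ 2), Finset.mul_sum (a := L ^ 2)]
  gcongr with m
  rw [← mul_pow, norm_sub_rev (v m)]
  exact pow_le_pow_left₀ (norm_nonneg _) (hQ.2 m w (v m)) 2

theorem norm_gradient_globalLoss_sub_le (hQ : Q.IsSmooth L) (hL : 0 < L) (hM : 1 ≤ M)
    (w w' : Vec d) : ‖gradient Q.globalLoss w - gradient Q.globalLoss w'‖ ≤ L * ‖w - w'‖ := by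
  have h := norm_gradient_globalLoss_sub_mean_sq_le hQ w fun _ => w'
  have hM' : (M : ℝ) ≠ 0 := by positivity
  rw [← gradient_globalLoss hQ, Finset.sum_const, Finset.card_univ, Fintype.card_fin,
    nsmul_eq_mul, ← mul_assoc (1 / (M : ℝ)), one_div_mul_cancel hM', one_mul, norm_sub_rev w',
    ← mul_pow] at h
  exact le_of_sq_le_sq h (by positivity)

theorem continuous_gradient_globalLoss (hQ : Q.IsSmooth L) (hL : 0 < L) (hM : 1 ≤ M) :
    Continuous (gradient Q.globalLoss) :=
  (LipschitzWith.of_dist_le_mul (K := L.toNNReal) fun x y => by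
    rw [dist_eq_norm, dist_eq_norm, Real.coe_toNNReal _ hL.le]
    exact norm_gradient_globalLoss_sub_le hQ hL hM x y).continuous

end GlobalLoss

/-! ### The error-corrected average and the deviation of local models from it. -/

/-- The average of the local models after adding back the compression errors, which evolves by
uncompressed averaged gradient steps. -/
noncomputable def State.center {M d : ℕ} (s : State M d) : Vec d :=
  (1 / (M : ℝ)) • ∑ m, (s.what m - s.err m)

/-- The mean squared distance of the local models from the center. -/
noncomputable def State.spread {M d : ℕ} (s : State M d) : ℝ :=
  (1 / (M : ℝ)) * ∑ m, ‖s.what m - s.center‖ ^ 2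

section Step

variable {M d : ℕ} {H : ℕ} {k : Fin M → ℕ} {η : ℝ} {t : ℕ}

/-- At a synchronization the mean of `topK u` is subtracted from w and reappears through the new
error u − `topK u`; the two cancel, leaving w − mean u, which is the mean of half − err. -/
theorem center_step (hM : 1 ≤ M) (g : Fin M → Vec d) (s : State M d) :
    (step H k η t g s).center = s.center - η • ((1 / (M : ℝ)) • ∑ m, g m) := by
  have hM' : (M : ℝ) ≠ 0 := by positivity
  by_cases h : H ∣ t + 1
  · simp only [State.center, step, h, if_true, Finset.sum_sub_distrib, Finset.sum_add_distrib,
      Finset.sum_const, Finset.card_univ, Fintype.card_fin, ← Nat.cast_smul_eq_nsmul ℝ,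
      ← Finset.smul_sum, smul_sub, smul_add, smul_smul, one_div_mul_cancel hM', mul_one_div_cancel hM',
      one_smul]
    rw [mul_comm η]
    abel
  · simp only [State.center, step, h, if_false, Finset.sum_sub_distrib, ← Finset.smul_sum, smul_sub,
      smul_smul]
    rw [mul_comm η]
    abel

/-- The center is the mean local model minus the mean error. The mean local model minimizes the sum
of squared distances, so it may be exchanged for `s.w`. -/
theorem spread_le (hM : 1 ≤ M) (s : State M d) :
    s.spread ≤ 2 * ((1 / (M : ℝ)) * ∑ m, ‖s.what m - s.w‖ ^ 2)
      + 2 * ((1 / (M : ℝ)) * ∑ m, ‖s.err m‖ ^ 2) := by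
  have hM' : (M : ℝ) ≠ 0 := by positivity
  have : Nonempty (Fin M) := ⟨⟨0, hM⟩⟩
  set a : Vec d := (1 / (M : ℝ)) • ∑ m, s.what m with ha
  set e : Vec d := (1 / (M : ℝ)) • ∑ m, s.err m with he
  have hc : s.center = a - e := by
    rw [State.center, Finset.sum_sub_distrib, smul_sub]
  have h1 : ∀ m, ‖s.what m - s.center‖ ^ 2 ≤ 2 * ‖s.what m - a‖ ^ 2 + 2 * ‖e‖ ^ 2 := by
    intro m
    have := norm_add_sq_le_young (s.what m - a) e one_pos
    rw [hc, show s.what m - (a - e) = s.what m - a + e by abel]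
    norm_num at this
    linarith
  have h2 := sum_norm_sub_mean_sq_le s.what s.w
  have h3 := norm_mean_sq_le s.err
  rw [Fintype.card_fin] at h2 h3
  calc s.spread ≤ (1 / (M : ℝ)) * ∑ m, (2 * ‖s.what m - a‖ ^ 2 + 2 * ‖e‖ ^ 2) := by
        unfold State.spread; gcongr with m; exact h1 m
    _ = 2 * ((1 / (M : ℝ)) * ∑ m, ‖s.what m - a‖ ^ 2) + 2 * ‖e‖ ^ 2 := by
        rw [Finset.sum_add_distrib, ← Finset.mul_sum]
        simp
        field_simp
    _ ≤ _ := by gcongr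

theorem mean_norm_gradient_sq_le {Q : Problem M d} {L : ℝ} (hQ : Q.IsSmooth L) (hL : 0 < L)
    (hM : 1 ≤ M) (s : State M d) :
    (1 / (M : ℝ)) * ∑ m, ‖gradient Q.globalLoss (s.what m)‖ ^ 2
      ≤ 2 * ‖gradient Q.globalLoss s.center‖ ^ 2 + 2 * (L ^ 2 * s.spread) := by
  have hM' : (M : ℝ) ≠ 0 := by positivity
  have h1 : ∀ m, ‖gradient Q.globalLoss (s.what m)‖ ^ 2
      ≤ 2 * ‖gradient Q.globalLoss s.center‖ ^ 2 + 2 * (L ^ 2 * ‖s.what m - s.center‖ ^ 2) := by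
    intro m
    have h2 := norm_add_sq_le_young (gradient Q.globalLoss s.center)
      (gradient Q.globalLoss (s.what m) - gradient Q.globalLoss s.center) one_pos
    rw [add_sub_cancel] at h2
    have h3 := pow_le_pow_left₀ (norm_nonneg _)
      (norm_gradient_globalLoss_sub_le hQ hL hM (s.what m) s.center) 2
    norm_num at h2
    nlinarith
  calc _ ≤ (1 / (M : ℝ)) * ∑ m, (2 * ‖gradient Q.globalLoss s.center‖ ^ 2
        + 2 * (L ^ 2 * ‖s.what m - s.center‖ ^ 2)) := by gcongr with m; exact h1 m
    _ = _ := by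
        unfold State.spread
        rw [Finset.sum_add_distrib, ← Finset.mul_sum, ← Finset.mul_sum, ← Finset.mul_sum]
        simp
        field_simp

end Step

/-! ### Trajectories as functions of the mini-batches. -/

section Path

variable {M d : ℕ} (Q : Problem M d) (S : Sampling) (b : ℕ → ℕ) (T : ℕ)

/-- The mini-batches of a run of `T` iterations. -/
abbrev Batches := (p : Fin M × Fin T) → Fin (b p.2) → Fin (Q.n p.1)

/-- The law of independent uniform mini-batches. -/
noncomputable def batchLaw : Measure (Batches Q b T) :=
  Measure.pi fun p => uniformOn (S.batches (b p.2) (Q.n p.1))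

variable {Q b T}

/-- The mini-batch of participant `m` at iteration `t`, with a dummy value for `t ≥ T`. -/
def Batches.at (β : Batches Q b T) (m : Fin M) (t : ℕ) : Fin (b t) → Fin (Q.n m) :=
  if h : t < T then β (m, ⟨t, h⟩) else fun _ => ⟨0, Q.n_pos m⟩

variable (H : ℕ) (k : Fin M → ℕ) (η : ℝ)

/-- The trajectory as a function of the initial model and the mini-batches. -/
noncomputable def path (w : Vec d) (β : Batches Q b T) (t : ℕ) : State M d :=
  trajectory Q H k η b w β.at t

/-- The stochastic gradients at the state `s` in iteration `t`. -/
noncomputable def grads (s : State M d) (β : Batches Q b T) (t : ℕ) (m : Fin M) : Vec d :=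
  Q.batchGrad m (β.at m t) (s.what m)

theorem path_succ (w : Vec d) (β : Batches Q b T) (t : ℕ) :
    path H k η w β (t + 1) = step H k η t (grads (path H k η w β t) β t) (path H k η w β t) := rfl

theorem trajectory_congr (w : Vec d) {B B' : (m : Fin M) → (t : ℕ) → Fin (b t) → Fin (Q.n m)}
    {t : ℕ} (h : ∀ s < t, ∀ m, B m s = B' m s) :
    trajectory Q H k η b w B t = trajectory Q H k η b w B' t := by
  induction t with
  | zero => rfl
  | succ t ih =>
    simp only [trajectory]
    rw [ih fun s hs => h s (by omega)]
    simp_rw [h t (by omega)]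

theorem what_eq_w_of_dvd (w : Vec d) (β : Batches Q b T) {t : ℕ} (h : H ∣ t) (m : Fin M) :
    (path H k η w β t).what m = (path H k η w β t).w := by
  cases t with
  | zero => rfl
  | succ t => rw [path_succ]; simp [step, h]

variable [∀ p : Fin M × Fin T, IsProbabilityMeasure (uniformOn (S.batches (b p.2) (Q.n p.1)))]

instance : IsProbabilityMeasure (batchLaw Q S b T) := by
  unfold batchLaw; infer_instance

/-- The state at time t depends only on earlier batches, so the batches of iteration t can be
redrawn independently with the state frozen: the tower property in integral form. -/
theorem integral_path_grads (w : Vec d) (t : ℕ) (φ : State M d → (Fin M → Vec d) → ℝ) :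
    ∫ β, φ (path H k η w β t) (grads (path H k η w β t) β t) ∂(batchLaw Q S b T)
      = ∫ β, ∫ γ, φ (path H k η w β t) (grads (path H k η w β t) γ t)
        ∂(batchLaw Q S b T) ∂(batchLaw Q S b T) := by
  have h := integral_resample (fun p : Fin M × Fin T => uniformOn (S.batches (b p.2) (Q.n p.1)))
    (fun p => p.2.val = t)
    (fun β => φ (path H k η w β t) (grads (path H k η w β t) β t))
  refine h.trans ?_
  refine integral_congr_ae (ae_of_all _ fun β => integral_congr_ae (ae_of_all _ fun γ => ?_))
  simp only
  set β' : Batches Q b T := fun p => if p.2.val = t then γ p else β p with hβ'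
  have h1 : path H k η w β' t = path H k η w β t := by
    refine trajectory_congr H k η w fun s hs m => ?_
    unfold Batches.at
    split_ifs
    · simp [hβ', hs.ne]
    · rfl
  have h2 : ∀ m, β'.at m t = Batches.at (Q := Q) γ m t := by
    intro m
    unfold Batches.at
    split_ifs
    · simp [hβ']
    · rfl
  rw [h1]
  unfold grads
  simp_rw [h2]

variable {S}

theorem integral_comp_at {E : Type*} [NormedAddCommGroup E] [NormedSpace ℝ E] {t : ℕ} (ht : t < T)
    (m : Fin M) (f : (Fin (b t) → Fin (Q.n m)) → E) :
    ∫ β, f (β.at m t) ∂(batchLaw Q S b T) = ∫ B, f B ∂(uniformOn (S.batches (b t) (Q.n m))) := by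
  have := integral_comp_eval
    (μ := fun p : Fin M × Fin T => uniformOn (S.batches (b p.2) (Q.n p.1)))
    (i := (m, ⟨t, ht⟩)) (f := f) Integrable.of_finite.aestronglyMeasurable
  rw [← this]
  unfold batchLaw Batches.at
  simp [ht]

theorem integral_inner_at_eq_zero {E : Type*} [NormedAddCommGroup E] [InnerProductSpace ℝ E]
    [CompleteSpace E] {t : ℕ} (ht : t < T) {m m' : Fin M} (hm : m ≠ m')
    (f : (Fin (b t) → Fin (Q.n m)) → E) (g : (Fin (b t) → Fin (Q.n m')) → E)
    (hf : ∫ B, f B ∂(uniformOn (S.batches (b t) (Q.n m))) = 0) :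
    ∫ β, inner ℝ (f (β.at m t)) (g (β.at m' t)) ∂(batchLaw Q S b T) = 0 := by
  have := integral_inner_eq_zero
    (fun p : Fin M × Fin T => uniformOn (S.batches (b p.2) (Q.n p.1)))
    (i := (m, ⟨t, ht⟩)) (j := (m', ⟨t, ht⟩)) (fun h => hm (congrArg Prod.fst h)) f g hf
  rw [← this]
  unfold batchLaw Batches.at
  simp [ht]

end Path

section Convergence

variable {M d : ℕ} {Q : Problem M d} {S : Sampling} {b : ℕ → ℕ} {T H : ℕ} {k : Fin M → ℕ}
  {η L G V : ℝ}
  [∀ p : Fin M × Fin T, IsProbabilityMeasure (uniformOn (S.batches (b p.2) (Q.n p.1)))]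

/-! ### Second moments of local drift and stored error. -/

section Moments

theorem integral_norm_grads_sq_le (hG : ∀ t < T, Q.BoundedSecondMoment S (b t) G) {t : ℕ}
    (ht : t < T) (w : Vec d) (m : Fin M) :
    ∫ β, ‖grads (path H k η w β t) β t m‖ ^ 2 ∂(batchLaw Q S b T) ≤ G ^ 2 := by
  rw [integral_path_grads S H k η w t fun _ g => ‖g m‖ ^ 2]
  have : ∀ β : Batches Q b T,
      ∫ γ, ‖grads (path H k η w β t) γ t m‖ ^ 2 ∂(batchLaw Q S b T) ≤ G ^ 2 := by
    intro β
    have h := integral_comp_at (Q := Q) (S := S) (b := b) ht m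
      fun B => ‖Q.batchGrad m B ((path H k η w β t).what m)‖ ^ 2
    exact h.trans_le (hG t ht m _)
  refine (integral_mono Integrable.of_finite Integrable.of_finite this).trans ?_
  simp

/-- Local drift right before a possible synchronization. -/
theorem integral_norm_half_sub_sq_le (hη : 0 ≤ η) (hH : 1 ≤ H)
    (hG : ∀ t < T, Q.BoundedSecondMoment S (b t) G) {t : ℕ} (ht : t < T) (w : Vec d)
    (m : Fin M) :
    ∫ β, ‖(path H k η w β t).what m - η • grads (path H k η w β t) β t m
      - (path H k η w β t).w‖ ^ 2 ∂(batchLaw Q S b T) ≤ (((t % H : ℕ) + 1) * (η * G)) ^ 2 := by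
  induction t with
  | zero =>
    have h1 : ∀ β : Batches Q b T, ‖(path H k η w β 0).what m
        - η • grads (path H k η w β 0) β 0 m - (path H k η w β 0).w‖ ^ 2
        = η ^ 2 * ‖grads (path H k η w β 0) β 0 m‖ ^ 2 := by
      intro β
      rw [what_eq_w_of_dvd H k η w β (dvd_zero H) m, sub_sub_cancel_left, norm_neg, norm_smul,
        mul_pow, Real.norm_of_nonneg hη]
    simp_rw [h1]
    rw [integral_const_mul]
    have := integral_norm_grads_sq_le (H := H) (k := k) (η := η) hG ht w m
    simp only [Nat.zero_mod, Nat.cast_zero, zero_add, one_mul, mul_pow]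
    gcongr
  | succ t ih =>
    have ih := ih (by omega)
    have hg := integral_norm_grads_sq_le (H := H) (k := k) (η := η) hG ht w m
    by_cases h : H ∣ t + 1
    · have h1 : ∀ β : Batches Q b T, ‖(path H k η w β (t + 1)).what m
          - η • grads (path H k η w β (t + 1)) β (t + 1) m - (path H k η w β (t + 1)).w‖ ^ 2
          = η ^ 2 * ‖grads (path H k η w β (t + 1)) β (t + 1) m‖ ^ 2 := by
        intro β
        rw [what_eq_w_of_dvd H k η w β h m, sub_sub_cancel_left, norm_neg, norm_smul,
          mul_pow, Real.norm_of_nonneg hη]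
      simp_rw [h1]
      rw [integral_const_mul, Nat.mod_eq_zero_of_dvd h]
      simp only [Nat.cast_zero, zero_add, one_mul, mul_pow]
      gcongr
    · set j : ℝ := ((t % H : ℕ) : ℝ) + 1 with hj
      have hj0 : 0 < j := by positivity
      have hmod : (((t + 1) % H : ℕ) : ℝ) = j := by
        have : (t + 1) % H = t % H + 1 := by
          have h0 : (t % H + 1) % H = (t + 1) % H := Nat.mod_add_mod t H 1
          rcases lt_or_ge (t % H + 1) H with h' | h'
          · rw [← h0, Nat.mod_eq_of_lt h']
          · exfalso
            have h'' : t % H + 1 = H := le_antisymm (Nat.mod_lt t hH) h'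
            rw [h'', Nat.mod_self] at h0
            exact h (Nat.dvd_of_mod_eq_zero h0.symm)
        rw [this]; push_cast; rfl
      rw [hmod]
      -- Here j counts the local steps accumulated so far. Young's parameter 1/j is exact for the
      -- induction: (1 + 1/j) j² + (1 + j) = (j + 1)².
      have h1 : ∀ β : Batches Q b T, ‖(path H k η w β (t + 1)).what m
          - η • grads (path H k η w β (t + 1)) β (t + 1) m - (path H k η w β (t + 1)).w‖ ^ 2
          ≤ (1 + j⁻¹) * ‖(path H k η w β t).what m - η • grads (path H k η w β t) β t m
              - (path H k η w β t).w‖ ^ 2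
            + (1 + j) * (η ^ 2 * ‖grads (path H k η w β (t + 1)) β (t + 1) m‖ ^ 2) := by
        intro β
        have h2 : (path H k η w β (t + 1)).what m
            = (path H k η w β t).what m - η • grads (path H k η w β t) β t m := by
          rw [path_succ]; simp [step, h]
        have h3 : (path H k η w β (t + 1)).w = (path H k η w β t).w := by
          rw [path_succ]; simp [step, h]
        rw [h2, h3, sub_right_comm, sub_eq_add_neg _ (η • grads _ _ (t + 1) m)]
        refine (norm_add_sq_le_young _ _ (inv_pos.mpr hj0)).trans_eq ?_
        rw [norm_neg, norm_smul, mul_pow, Real.norm_of_nonneg hη, inv_inv]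
      refine (integral_mono Integrable.of_finite Integrable.of_finite h1).trans ?_
      rw [integral_add Integrable.of_finite Integrable.of_finite, integral_const_mul,
        integral_const_mul, integral_const_mul]
      calc _ ≤ (1 + j⁻¹) * (j * (η * G)) ^ 2 + (1 + j) * (η ^ 2 * G ^ 2) := by gcongr
        _ = _ := by field_simp; ring

theorem integral_norm_what_sub_sq_le (hη : 0 ≤ η) (hG0 : 0 ≤ G) (hH : 1 ≤ H)
    (hG : ∀ t < T, Q.BoundedSecondMoment S (b t) G) {t : ℕ} (ht : t < T) (w : Vec d)
    (m : Fin M) :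
    ∫ β, ‖(path H k η w β t).what m - (path H k η w β t).w‖ ^ 2 ∂(batchLaw Q S b T)
      ≤ (H * (η * G)) ^ 2 := by
  by_cases h : H ∣ t
  · have : ∀ β : Batches Q b T, (path H k η w β t).what m - (path H k η w β t).w = 0 := fun β =>
      sub_eq_zero.mpr (what_eq_w_of_dvd H k η w β h m)
    simp_rw [this]
    simp
    positivity
  · obtain ⟨s, rfl⟩ : ∃ s, t = s + 1 := Nat.exists_eq_succ_of_ne_zero (by rintro rfl; simp at h)
    have h1 : ∀ β : Batches Q b T, (path H k η w β (s + 1)).what m - (path H k η w β (s + 1)).w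
        = (path H k η w β s).what m - η • grads (path H k η w β s) β s m
          - (path H k η w β s).w := by
      intro β
      rw [path_succ]; simp [step, h]
    simp_rw [h1]
    refine (integral_norm_half_sub_sq_le hη hH hG (by omega) w m).trans ?_
    have : ((s % H : ℕ) : ℝ) + 1 ≤ H := by exact_mod_cast Nat.mod_lt s hH
    gcongr

theorem integral_norm_err_sq_le (hη : 0 ≤ η) (hG0 : 0 ≤ G) (hH : 1 ≤ H)
    (hG : ∀ t < T, Q.BoundedSecondMoment S (b t) G) {t : ℕ} (ht : t ≤ T) (w : Vec d)
    {m : Fin M} (hk : 1 ≤ k m) (hkd : k m ≤ d) :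
    ∫ β, ‖(path H k η w β t).err m‖ ^ 2 ∂(batchLaw Q S b T)
      ≤ 4 * ((d : ℝ) / k m) ^ 2 * (H * (η * G)) ^ 2 := by
  have hk0 : (0 : ℝ) < k m := by exact_mod_cast hk
  have hkd' : (k m : ℝ) ≤ d := by exact_mod_cast hkd
  induction t with
  | zero =>
    simp [path, trajectory]
    positivity
  | succ t ih =>
    have ih := ih (by omega)
    by_cases h : H ∣ t + 1
    · set δ : ℝ := (d : ℝ) / k m with hδ
      have hδ1 : 1 ≤ δ := (one_le_div hk0).mpr hkd'
      have hδ' : (k m : ℝ) / d = δ⁻¹ := by rw [hδ, inv_div]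
      have hδ0 : 0 ≤ 1 - δ⁻¹ := sub_nonneg.mpr (inv_le_one_of_one_le₀ hδ1)
      set R := (H * (η * G)) ^ 2 with hR
      have hR0 : 0 ≤ R := sq_nonneg _
      -- With Young's parameter 1/(2δ), inserting the bound 4δ²R for the old error gives (4δ² − 3 −
      -- 1/δ) R, so that bound is preserved.
      have h1 : ∀ β : Batches Q b T, ‖(path H k η w β (t + 1)).err m‖ ^ 2
          ≤ (1 - δ⁻¹) * ((1 + (2 * δ)⁻¹) * ‖(path H k η w β t).err m‖ ^ 2
            + (1 + 2 * δ) * ‖(path H k η w β t).what m - η • grads (path H k η w β t) β t m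
              - (path H k η w β t).w‖ ^ 2) := by
        intro β
        rw [path_succ]
        simp only [step, h, if_true]
        refine (norm_sub_topK_sq_le hk hkd _).trans ?_
        rw [hδ', add_sub_assoc]
        gcongr
        refine (norm_add_sq_le_young _ _ (by positivity : 0 < (2 * δ)⁻¹)).trans_eq ?_
        rw [inv_inv, norm_sub_rev (path H k η w β t).w]
      have h2 : ∫ β, ‖(path H k η w β t).what m - η • grads (path H k η w β t) β t m
          - (path H k η w β t).w‖ ^ 2 ∂(batchLaw Q S b T) ≤ R := by
        refine (integral_norm_half_sub_sq_le hη hH hG (by omega) w m).trans ?_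
        have : ((t % H : ℕ) : ℝ) + 1 ≤ H := by exact_mod_cast Nat.mod_lt t hH
        rw [hR]
        gcongr
      refine (integral_mono Integrable.of_finite Integrable.of_finite h1).trans ?_
      rw [integral_const_mul, integral_add Integrable.of_finite Integrable.of_finite,
        integral_const_mul, integral_const_mul]
      calc _ ≤ (1 - δ⁻¹) * ((1 + (2 * δ)⁻¹) * (4 * δ ^ 2 * R) + (1 + 2 * δ) * R) := by gcongr
        _ = (4 * δ ^ 2 - 3 - δ⁻¹) * R := by field_simp; ring
        _ ≤ _ := by
          have : 0 < δ⁻¹ := by positivity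
          gcongr
          linarith
    · have h1 : ∀ β : Batches Q b T, (path H k η w β (t + 1)).err m = (path H k η w β t).err m := by
        intro β
        rw [path_succ]; simp [step, h]
      simp_rw [h1]
      exact ih

theorem sq_rmsSparsity (d : ℕ) (k : Fin M → ℕ) :
    rmsSparsity d k ^ 2 = (1 / (M : ℝ)) * ∑ m, ((d : ℝ) / (k m : ℝ)) ^ 2 :=
  Real.sq_sqrt (by positivity)

theorem integral_spread_le (hη : 0 ≤ η) (hG0 : 0 ≤ G) (hM : 1 ≤ M) (hH : 1 ≤ H)
    (hG : ∀ t < T, Q.BoundedSecondMoment S (b t) G) {t : ℕ} (ht : t < T) (w : Vec d)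
    (hk : ∀ m, 1 ≤ k m ∧ k m ≤ d) :
    ∫ β, (path H k η w β t).spread ∂(batchLaw Q S b T)
      ≤ 2 * (4 * rmsSparsity d k ^ 2 + 1) * (H * (η * G)) ^ 2 := by
  have hM' : (M : ℝ) ≠ 0 := by positivity
  refine (integral_mono Integrable.of_finite Integrable.of_finite
    fun β => spread_le hM (path H k η w β t)).trans ?_
  rw [integral_add Integrable.of_finite Integrable.of_finite, integral_const_mul,
    integral_const_mul, integral_const_mul, integral_const_mul,
    integral_finsetSum _ fun _ _ => Integrable.of_finite,
    integral_finsetSum _ fun _ _ => Integrable.of_finite]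
  calc _ ≤ 2 * ((1 / (M : ℝ)) * ∑ m : Fin M, (H * (η * G)) ^ 2)
        + 2 * ((1 / (M : ℝ)) * ∑ m, 4 * ((d : ℝ) / k m) ^ 2 * (H * (η * G)) ^ 2) := by
        gcongr with m _ m _
        · exact integral_norm_what_sub_sq_le hη hG0 hH hG ht w m
        · exact integral_norm_err_sq_le hη hG0 hH hG ht.le w (hk m).1 (hk m).2
    _ = _ := by
        rw [← Finset.sum_mul, ← Finset.mul_sum, sq_rmsSparsity]
        simp
        field_simp
        ring

end Moments

/-! ### Expected descent along the center. -/

section Descent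

/-- The term linear in the noise vanishes by unbiasedness and the cross terms by independence of
participants; M diagonal terms, each at most V, remain with weight 1/M². -/
theorem integral_norm_mean_grads_sq_le (hQ : Q.IsSmooth L) (hM : 1 ≤ M) {t : ℕ} (ht : t < T)
    (hb : 1 ≤ b t)
    (hV : ∀ m w, ∫ B, ‖Q.batchGrad m B w - gradient (Q.localLoss m) w‖ ^ 2
      ∂(uniformOn (S.batches (b t) (Q.n m))) ≤ V) (s : State M d) :
    ∫ γ : Batches Q b T, ‖(1 / (M : ℝ)) • ∑ m, grads s γ t m‖ ^ 2 ∂(batchLaw Q S b T)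
      ≤ ‖(1 / (M : ℝ)) • ∑ m, gradient (Q.localLoss m) (s.what m)‖ ^ 2 + V / M := by
  have hM' : (0 : ℝ) < M := by positivity
  have hprob : ∀ m, IsProbabilityMeasure (uniformOn (S.batches (b t) (Q.n m))) := fun m =>
    inferInstanceAs (IsProbabilityMeasure (uniformOn
      (S.batches (b (m, (⟨t, ht⟩ : Fin T)).2) (Q.n (m, (⟨t, ht⟩ : Fin T)).1))))
  set h := (1 / (M : ℝ)) • ∑ m, gradient (Q.localLoss m) (s.what m) with hh
  let a : (m : Fin M) → (Fin (b t) → Fin (Q.n m)) → Vec d := fun m B =>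
    Q.batchGrad m B (s.what m) - gradient (Q.localLoss m) (s.what m)
  have ha : ∀ m, ∫ B, a m B ∂(uniformOn (S.batches (b t) (Q.n m))) = 0 := by
    intro m
    rw [integral_sub Integrable.of_finite Integrable.of_finite, integral_batchGrad Q hQ.1 hb]
    simp
  have hdec : ∀ γ : Batches Q b T, ‖(1 / (M : ℝ)) • ∑ m, grads s γ t m‖ ^ 2
      = ‖h‖ ^ 2 + 2 * ((1 / (M : ℝ)) * ∑ m, inner ℝ h (a m (γ.at m t)))
        + (1 / (M : ℝ)) ^ 2 * ∑ m, ∑ m', inner ℝ (a m (γ.at m t)) (a m' (γ.at m' t)) := by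
    intro γ
    have h1 : (1 / (M : ℝ)) • ∑ m, grads s γ t m = h + (1 / (M : ℝ)) • ∑ m, a m (γ.at m t) := by
      rw [hh, ← smul_add, ← Finset.sum_add_distrib]
      simp [a, grads]
    rw [h1, norm_add_sq_real, inner_smul_right, inner_sum,
      norm_smul _ (∑ m, a m (γ.at m t)), mul_pow, Real.norm_of_nonneg (by positivity), ← real_inner_self_eq_norm_sq (∑ m, a m (γ.at m t)),
      sum_inner]
    simp_rw [inner_sum]
  have hlin : ∀ m, ∫ γ : Batches Q b T, inner ℝ h (a m (γ.at m t)) ∂(batchLaw Q S b T) = 0 := by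
    intro m
    rw [integral_comp_at ht m fun B => (inner ℝ h (a m B) : ℝ), integral_inner Integrable.of_finite,
      ha, inner_zero_right]
  have hcross : ∀ m, ∑ m', ∫ γ : Batches Q b T, inner ℝ (a m (γ.at m t)) (a m' (γ.at m' t))
      ∂(batchLaw Q S b T) ≤ V := by
    intro m
    rw [Finset.sum_eq_single m (fun m' _ hm =>
      integral_inner_at_eq_zero ht hm.symm (a m) (a m') (ha m)) (by simp)]
    rw [integral_comp_at ht m fun B => (inner ℝ (a m B) (a m B) : ℝ)]
    simp_rw [real_inner_self_eq_norm_sq]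
    exact hV m _
  simp_rw [hdec]
  rw [integral_add Integrable.of_finite Integrable.of_finite,
    integral_add Integrable.of_finite Integrable.of_finite, integral_const_mul, integral_const_mul,
    integral_const_mul, integral_finsetSum _ fun _ _ => Integrable.of_finite,
    integral_finsetSum _ fun _ _ => Integrable.of_finite]
  simp_rw [hlin, integral_finsetSum _ fun _ _ => Integrable.of_finite]
  have h3 : (1 / (M : ℝ)) ^ 2 * ∑ m, ∑ m', ∫ γ : Batches Q b T,
      inner ℝ (a m (γ.at m t)) (a m' (γ.at m' t)) ∂(batchLaw Q S b T) ≤ V / M := by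
    calc _ ≤ (1 / (M : ℝ)) ^ 2 * ∑ m : Fin M, V := by gcongr with m; exact hcross m
      _ = V / M := by simp; field_simp
  simp
  simp at h3
  exact h3

theorem integral_mean_grads (hQ : Q.IsSmooth L) {t : ℕ} (ht : t < T) (hb : 1 ≤ b t)
    (s : State M d) :
    ∫ γ : Batches Q b T, (1 / (M : ℝ)) • ∑ m, grads s γ t m ∂(batchLaw Q S b T)
      = (1 / (M : ℝ)) • ∑ m, gradient (Q.localLoss m) (s.what m) := by
  rw [integral_smul, integral_finsetSum _ fun _ _ => Integrable.of_finite]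
  congr 1
  refine Finset.sum_congr rfl fun m _ => ?_
  have : IsProbabilityMeasure (uniformOn (S.batches (b t) (Q.n m))) :=
    inferInstanceAs (IsProbabilityMeasure (uniformOn
      (S.batches (b (m, (⟨t, ht⟩ : Fin T)).2) (Q.n (m, (⟨t, ht⟩ : Fin T)).1))))
  unfold grads
  rw [integral_comp_at ht m fun B => Q.batchGrad m B (s.what m), integral_batchGrad Q hQ.1 hb]

/-- Expected decrease of the objective in one iteration from a fixed state. -/
theorem integral_globalLoss_step_le (hQ : Q.IsSmooth L) (hL : 0 < L) (hM : 1 ≤ M) (hη : 0 ≤ η)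
    (hηL : L * η ≤ 1) {t : ℕ} (ht : t < T) (hb : 1 ≤ b t)
    (hV : ∀ m w, ∫ B, ‖Q.batchGrad m B w - gradient (Q.localLoss m) w‖ ^ 2
      ∂(uniformOn (S.batches (b t) (Q.n m))) ≤ V) (s : State M d) :
    ∫ γ : Batches Q b T, Q.globalLoss (step H k η t (grads s γ t) s).center ∂(batchLaw Q S b T)
      ≤ Q.globalLoss s.center - η / 2 * ‖gradient Q.globalLoss s.center‖ ^ 2
        + η / 2 * (L ^ 2 * s.spread) + L * η ^ 2 / 2 * (V / M) := by
  set c := s.center with hc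
  set h := (1 / (M : ℝ)) • ∑ m, gradient (Q.localLoss m) (s.what m) with hh
  have h1 : ∀ γ : Batches Q b T, Q.globalLoss (step H k η t (grads s γ t) s).center
      ≤ Q.globalLoss c + (-η) * inner ℝ (gradient Q.globalLoss c) ((1 / (M : ℝ)) • ∑ m, grads s γ t m)
        + L * η ^ 2 / 2 * ‖(1 / (M : ℝ)) • ∑ m, grads s γ t m‖ ^ 2 := by
    intro γ
    rw [center_step hM, sub_eq_add_neg]
    refine (le_quadratic_of_lipschitz_gradient (differentiable_globalLoss hQ)
      (norm_gradient_globalLoss_sub_le hQ hL hM) _ _).trans_eq ?_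
    rw [inner_neg_right, inner_smul_right, norm_neg, norm_smul η, mul_pow, Real.norm_of_nonneg hη]
    ring
  refine (integral_mono Integrable.of_finite Integrable.of_finite h1).trans ?_
  rw [integral_add Integrable.of_finite Integrable.of_finite,
    integral_add Integrable.of_finite Integrable.of_finite, integral_const_mul, integral_const_mul,
    integral_inner Integrable.of_finite, integral_mean_grads hQ ht hb, ← hh]
  have h2 := integral_norm_mean_grads_sq_le hQ hM ht hb hV s
  rw [← hh] at h2
  have h3 := norm_gradient_globalLoss_sub_mean_sq_le hQ c s.what
  -- Expanding the square bounds −⟨∇F(c), h⟩ and leaves −‖h‖²/2, which absorbs the quadratic term of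
  -- the descent lemma because Lη ≤ 1.
  rw [← hh, norm_sub_sq_real] at h3
  change _ ≤ L ^ 2 * s.spread at h3
  have h4 : L * η ^ 2 / 2 * ∫ γ : Batches Q b T, ‖(1 / (M : ℝ)) • ∑ m, grads s γ t m‖ ^ 2
      ∂(batchLaw Q S b T) ≤ L * η ^ 2 / 2 * (‖h‖ ^ 2 + V / M) := by gcongr
  have h5 : L * η ^ 2 / 2 * ‖h‖ ^ 2 ≤ η / 2 * ‖h‖ ^ 2 := by
    gcongr
    nlinarith
  have h6 := mul_le_mul_of_nonneg_left h3 (by positivity : 0 ≤ η / 2)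
  simp only [integral_const, probReal_univ, smul_eq_mul, one_mul]
  linarith

theorem integral_globalLoss_center_le (hQ : Q.IsSmooth L) (hL : 0 < L) (hM : 1 ≤ M) (hη : 0 ≤ η)
    (hηL : L * η ≤ 1) (hb : ∀ t < T, 1 ≤ b t)
    (hV : ∀ t < T, ∀ m w, ∫ B, ‖Q.batchGrad m B w - gradient (Q.localLoss m) w‖ ^ 2
      ∂(uniformOn (S.batches (b t) (Q.n m))) ≤ V) {D : ℝ} (w : Vec d)
    (hD : ∀ t < T, ∫ β, (path H k η w β t).spread ∂(batchLaw Q S b T) ≤ D) {t : ℕ} (ht : t ≤ T) :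
    ∫ β, Q.globalLoss (path H k η w β t).center ∂(batchLaw Q S b T)
      + η / 2 * ∑ s ∈ Finset.range t,
        ∫ β, ‖gradient Q.globalLoss (path H k η w β s).center‖ ^ 2 ∂(batchLaw Q S b T)
      ≤ Q.globalLoss w + t * (η / 2 * (L ^ 2 * D) + L * η ^ 2 / 2 * (V / M)) := by
  induction t with
  | zero =>
    have : ∀ β : Batches Q b T, (path H k η w β 0).center = w := by
      intro β
      have hM' : (M : ℝ) ≠ 0 := by positivity
      simp [path, trajectory, State.center, ← Nat.cast_smul_eq_nsmul ℝ, smul_smul, hM']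
    simp [this]
  | succ t ih =>
    have ih := ih (by omega)
    have ht' : t < T := by omega
    have h1 : ∫ β, Q.globalLoss (path H k η w β (t + 1)).center ∂(batchLaw Q S b T)
        ≤ ∫ β, (Q.globalLoss (path H k η w β t).center
          - η / 2 * ‖gradient Q.globalLoss (path H k η w β t).center‖ ^ 2
          + η / 2 * (L ^ 2 * (path H k η w β t).spread) + L * η ^ 2 / 2 * (V / M))
          ∂(batchLaw Q S b T) := by
      simp_rw [path_succ]
      rw [integral_path_grads S H k η w t fun s g => Q.globalLoss (step H k η t g s).center]
      exact integral_mono Integrable.of_finite Integrable.of_finite fun β =>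
        integral_globalLoss_step_le hQ hL hM hη hηL ht' (hb t ht') (hV t ht') _
    rw [integral_add Integrable.of_finite Integrable.of_finite,
      integral_add Integrable.of_finite Integrable.of_finite,
      integral_sub Integrable.of_finite Integrable.of_finite, integral_const_mul,
      integral_const_mul, integral_const_mul] at h1
    simp only [integral_const, probReal_univ, smul_eq_mul, one_mul] at h1
    have h2 : η / 2 * (L ^ 2 * ∫ β, (path H k η w β t).spread ∂(batchLaw Q S b T))
        ≤ η / 2 * (L ^ 2 * D) := by gcongr; exact hD t ht'
    rw [Finset.sum_range_succ]
    push_cast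
    linarith

/-- Convergence from a deterministic initial model. -/
theorem sum_integral_norm_gradient_sq_le (hQ : Q.IsSmooth L) (hL : 0 < L) (hM : 1 ≤ M)
    (hH : 1 ≤ H) (hη : 0 ≤ η) (hηL : L * η ≤ 1) (hG0 : 0 ≤ G) (hb : ∀ t < T, 1 ≤ b t)
    (hV : ∀ t < T, ∀ m w, ∫ B, ‖Q.batchGrad m B w - gradient (Q.localLoss m) w‖ ^ 2
      ∂(uniformOn (S.batches (b t) (Q.n m))) ≤ V)
    (hG : ∀ t < T, Q.BoundedSecondMoment S (b t) G) (hk : ∀ m, 1 ≤ k m ∧ k m ≤ d)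
    (hbdd : BddBelow (Set.range Q.globalLoss)) (w : Vec d) :
    η * ∑ t ∈ Finset.range T, ∫ β, (1 / (M : ℝ)) *
        ∑ m, ‖gradient Q.globalLoss ((path H k η w β t).what m)‖ ^ 2 ∂(batchLaw Q S b T)
      ≤ 4 * (Q.globalLoss w - Q.optValue) + η * T *
        (8 * L ^ 2 * (4 * rmsSparsity d k ^ 2 + 1) * (H * (η * G)) ^ 2 + 2 * L * η * (V / M)) := by
  set D := 2 * (4 * rmsSparsity d k ^ 2 + 1) * (H * (η * G)) ^ 2 with hDdef
  have hD : ∀ t < T, ∫ β, (path H k η w β t).spread ∂(batchLaw Q S b T) ≤ D := fun t ht =>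
    integral_spread_le hη hG0 hM hH hG ht w hk
  have h1 := integral_globalLoss_center_le hQ hL hM hη hηL hb hV w hD le_rfl
  have h2 : Q.optValue ≤ ∫ β, Q.globalLoss (path H k η w β T).center ∂(batchLaw Q S b T) := by
    have : ∫ _ : Batches Q b T, Q.optValue ∂(batchLaw Q S b T) = Q.optValue := by simp
    rw [← this]
    exact integral_mono Integrable.of_finite Integrable.of_finite fun β => ciInf_le hbdd _
  have h3 : ∀ t ∈ Finset.range T, ∫ β, (1 / (M : ℝ)) *
      ∑ m, ‖gradient Q.globalLoss ((path H k η w β t).what m)‖ ^ 2 ∂(batchLaw Q S b T)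
      ≤ 2 * ∫ β, ‖gradient Q.globalLoss (path H k η w β t).center‖ ^ 2 ∂(batchLaw Q S b T)
        + 2 * (L ^ 2 * D) := by
    intro t ht
    refine (integral_mono Integrable.of_finite Integrable.of_finite fun β =>
      mean_norm_gradient_sq_le hQ hL hM (path H k η w β t)).trans ?_
    rw [integral_add Integrable.of_finite Integrable.of_finite, integral_const_mul,
      integral_const_mul, integral_const_mul]
    gcongr
    exact hD t (Finset.mem_range.mp ht)
  have h4 := mul_le_mul_of_nonneg_left (Finset.sum_le_sum h3) hη
  rw [Finset.sum_add_distrib, ← Finset.mul_sum] at h4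
  simp only [Finset.sum_const, Finset.card_range, nsmul_eq_mul] at h4
  refine h4.trans ?_
  rw [show 8 * L ^ 2 * (4 * rmsSparsity d k ^ 2 + 1) * (H * (η * G)) ^ 2 = 4 * (L ^ 2 * D) by
    rw [hDdef]; ring]
  linarith

/-- Jensen's inequality for the unbiased batch gradient. The uniform bound supplies integrability
and settles the case G² ≤ ε. -/
theorem norm_gradient_globalLoss_sq_le (hQ : Q.IsSmooth L) (hM : 1 ≤ M) (hT : 1 ≤ T)
    (hb : 1 ≤ b 0) (hG : Q.BoundedSecondMoment S (b 0) G) (w : Vec d) :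
    ‖gradient Q.globalLoss w‖ ^ 2 ≤ G ^ 2 := by
  have hM' : (0 : ℝ) < M := by positivity
  have h1 : ∀ m, ‖gradient (Q.localLoss m) w‖ ^ 2 ≤ G ^ 2 := by
    intro m
    have : IsProbabilityMeasure (uniformOn (S.batches (b 0) (Q.n m))) :=
      inferInstanceAs (IsProbabilityMeasure (uniformOn
        (S.batches (b (m, (⟨0, hT⟩ : Fin T)).2) (Q.n (m, (⟨0, hT⟩ : Fin T)).1))))
    set g := gradient (Q.localLoss m) w with hg
    refine le_trans ?_ (hG m w)
    have h2 : ∀ B : Fin (b 0) → Fin (Q.n m),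
        2 * inner ℝ g (Q.batchGrad m B w) - ‖g‖ ^ 2 ≤ ‖Q.batchGrad m B w‖ ^ 2 := by
      intro B
      have h3 := sq_nonneg ‖Q.batchGrad m B w - g‖
      rw [norm_sub_sq_real, real_inner_comm] at h3
      linarith
    refine le_trans (le_of_eq ?_) (integral_mono
      (μ := uniformOn (S.batches (b 0) (Q.n m))) Integrable.of_finite Integrable.of_finite h2)
    rw [integral_sub Integrable.of_finite Integrable.of_finite, integral_const_mul,
      integral_inner Integrable.of_finite, integral_batchGrad Q hQ.1 hb, ← hg,
      real_inner_self_eq_norm_sq]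
    simp
    ring
  rw [gradient_globalLoss hQ]
  have h := norm_mean_sq_le fun m => gradient (Q.localLoss m) w
  rw [Fintype.card_fin] at h
  calc _ ≤ _ := h
    _ ≤ (1 / (M : ℝ)) * ∑ m : Fin M, G ^ 2 :=
        mul_le_mul_of_nonneg_left (Finset.sum_le_sum fun m _ => h1 m) (by positivity)
    _ = G ^ 2 := by simp; field_simp

end Descent

end Convergence

/-! ### The explicit iteration count and its order. -/

section Parameters

variable {σ G L J ε : ℝ} {b₀ M H : ℕ} {δ : ℝ}

theorem iterationBound_pos (hσ : 0 < σ) (hG : 0 < G) (hL : 0 < L) (hJ : 0 < J) (hε : 0 < ε)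
    (hb : 1 ≤ b₀) (hM : 1 ≤ M) (hH : 1 ≤ H) :
    0 < iterationBound σ G L J ε b₀ M H δ := by
  have : (0 : ℝ) < b₀ := by exact_mod_cast hb
  have : (0 : ℝ) < M := by exact_mod_cast hM
  have : (0 : ℝ) < H := by exact_mod_cast hH
  unfold iterationBound
  positivity

theorem errorBound_iterationBound (hσ : 0 < σ) (hG : 0 < G) (hL : 0 < L) (hJ : 0 < J)
    (hε : 0 < ε) (hb : 1 ≤ b₀) (hM : 1 ≤ M) (hH : 1 ≤ H) :
    errorBound σ G L J b₀ M H δ (iterationBound σ G L J ε b₀ M H δ) = ε := by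
  have hb' : (0 : ℝ) < b₀ := by exact_mod_cast hb
  have hM' : (0 : ℝ) < M := by exact_mod_cast hM
  have hH' : (0 : ℝ) < H := by exact_mod_cast hH
  have hT := iterationBound_pos (δ := δ) hσ hG hL hJ hε hb hM hH
  set T := iterationBound σ G L J ε b₀ M H δ with hTdef
  set p := 12 * σ * J * √L / √(M * b₀) with hp
  set q := 8 * b₀ * M * L * G ^ 2 * J ^ 2 * H ^ 2 * (4 * δ ^ 2 + 1) / σ ^ 2 with hq
  have hp0 : 0 < p := by positivity
  have hq0 : 0 < q := by positivity
  have hpsq : p ^ 2 = 144 * σ ^ 2 * J ^ 2 * L / (M * b₀) := by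
    rw [hp, div_pow, Real.sq_sqrt (by positivity), mul_pow, Real.sq_sqrt hL.le]; ring
  set s := √(p ^ 2 / (4 * ε ^ 2) + q / ε) with hs
  have hs2 : s ^ 2 = p ^ 2 / (4 * ε ^ 2) + q / ε := Real.sq_sqrt (by positivity)
  have hs0 : 0 ≤ s := Real.sqrt_nonneg _
  have hTsq : T = (p / (2 * ε) + s) ^ 2 := by
    have h1 : 8 * b₀ * M * L * G ^ 2 * J ^ 2 * H ^ 2 * (4 * δ ^ 2 + 1) / (ε * σ ^ 2) = q / ε := by
      rw [hq]; field_simp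
    have h2 : 36 * L * σ ^ 2 * J ^ 2 / (ε ^ 2 * b₀ * M) = p ^ 2 / (4 * ε ^ 2) := by
      rw [hpsq]; field_simp; norm_num
    have h3 : 72 * L * σ ^ 2 * J ^ 2 / (ε ^ 2 * b₀ * M) = 2 * (p ^ 2 / (4 * ε ^ 2)) := by
      rw [← h2]; ring
    have h4 : 12 * σ * J * √L / (ε * √(M * b₀)) = p / ε := by
      rw [hp]; field_simp
    rw [hTdef, iterationBound, h1, h2, h3, h4, add_comm (q / ε) (p ^ 2 / (4 * ε ^ 2)), ← hs]
    have : (p / (2 * ε) + s) ^ 2 = p ^ 2 / (4 * ε ^ 2) + p / ε * s + s ^ 2 := by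
      field_simp; ring
    rw [this, hs2]; ring
  set x := p / (2 * ε) + s with hx
  have hx0 : 0 < x := by positivity
  have hroot : ε * x ^ 2 = p * x + q := by
    have h1 : s = x - p / (2 * ε) := by rw [hx]; ring
    rw [h1] at hs2
    field_simp at hs2
    have h2 : ε * (4 * (ε * x ^ 2 - p * x - q)) = 0 := by ring_nf at hs2 ⊢; nlinarith [hs2]
    have := (mul_eq_zero.mp h2).resolve_left hε.ne'
    linarith
  have hsq : √(M * T * b₀) = √(M * b₀) * x := by
    rw [hTsq, show (M : ℝ) * x ^ 2 * b₀ = (M * b₀) * x ^ 2 by ring,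
      Real.sqrt_mul (by positivity), Real.sqrt_sq hx0.le]
  have e1 : 12 * σ * J * √L / √(M * T * b₀) = p / x := by
    rw [hsq, hp]; field_simp
  have e2 : (4 * δ ^ 2 + 1) * (8 * b₀ * M * L * G ^ 2 * H ^ 2 * J ^ 2 / (σ ^ 2 * T)) = q / x ^ 2 := by
    rw [hTsq, hq]; field_simp
  rw [errorBound, e1, e2]
  have : p / x + q / x ^ 2 = (p * x + q) / x ^ 2 := by field_simp
  rw [this, ← hroot]; field_simp

theorem errorBound_anti (hσ : 0 < σ) (hL : 0 < L) (hJ : 0 < J)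
    (hb : 1 ≤ b₀) (hM : 1 ≤ M) {T₁ T₂ : ℝ} (h1 : 0 < T₁) (h : T₁ ≤ T₂) :
    errorBound σ G L J b₀ M H δ T₂ ≤ errorBound σ G L J b₀ M H δ T₁ := by
  have hb' : (0 : ℝ) < b₀ := by exact_mod_cast hb
  have hM' : (0 : ℝ) < M := by exact_mod_cast hM
  unfold errorBound
  gcongr

/-- Each term of `iterationBound` is at most a constant times M H² δ², a quantity that is at least
1; one factor H is lost on passing to rounds. -/
theorem exists_roundBound_le (hσ : 0 < σ) (hG : 0 < G) (hL : 0 < L) (hJ : 0 < J)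
    (hε : 0 < ε) (hb : 1 ≤ b₀) :
    ∃ C : ℝ, 0 < C ∧ ∀ (M H : ℕ) (δ : ℝ), 1 ≤ M → 1 ≤ H → 1 ≤ δ →
      roundBound σ G L J ε b₀ M H δ ≤ C * (M * H * δ ^ 2) := by
  have hb' : (0 : ℝ) < b₀ := by exact_mod_cast hb
  -- 40 = 8 · 5, from 4δ² + 1 ≤ 5δ².
  set A := 40 * b₀ * L * G ^ 2 * J ^ 2 / (ε * σ ^ 2) with hA
  set D := 36 * L * σ ^ 2 * J ^ 2 / (ε ^ 2 * b₀) with hD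
  set E := 12 * σ * J * √L / (ε * √b₀) with hE
  have hA0 : 0 < A := by positivity
  have hD0 : 0 < D := by positivity
  have hE0 : 0 < E := by positivity
  refine ⟨A + 2 * D + E * √(A + D), by positivity, fun M H δ hM hH hδ => ?_⟩
  have hM' : (1 : ℝ) ≤ M := by exact_mod_cast hM
  have hH' : (1 : ℝ) ≤ H := by exact_mod_cast hH
  set y := (M : ℝ) * H ^ 2 * δ ^ 2 with hy
  have hδ2 : 1 ≤ δ ^ 2 := one_le_pow₀ hδ
  have hH2 : (1 : ℝ) ≤ H ^ 2 := one_le_pow₀ hH'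
  have hy1 : 1 ≤ y := by
    have := one_le_mul_of_one_le_of_one_le (one_le_mul_of_one_le_of_one_le hM' hH2) hδ2
    exact this
  have t1 : 8 * b₀ * M * L * G ^ 2 * J ^ 2 * H ^ 2 * (4 * δ ^ 2 + 1) / (ε * σ ^ 2) ≤ A * y := by
    rw [hA, hy, div_mul_eq_mul_div]
    refine div_le_div_of_nonneg_right ?_ (by positivity)
    have : 0 < 8 * b₀ * M * L * G ^ 2 * J ^ 2 * H ^ 2 := by positivity
    nlinarith
  have t2 : 36 * L * σ ^ 2 * J ^ 2 / (ε ^ 2 * b₀ * M) ≤ D * y := by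
    have : 36 * L * σ ^ 2 * J ^ 2 / (ε ^ 2 * b₀ * M) ≤ D := by
      rw [hD]
      refine div_le_div_of_nonneg_left (by positivity) (by positivity) ?_
      exact le_mul_of_one_le_right (by positivity) hM'
    exact this.trans (le_mul_of_one_le_right hD0.le hy1)
  have t3 : 12 * σ * J * √L / (ε * √(M * b₀)) ≤ E := by
    rw [hE]
    refine div_le_div_of_nonneg_left (by positivity) (by positivity) ?_
    gcongr
    exact le_mul_of_one_le_left hb'.le hM'
  have t4 : √(8 * b₀ * M * L * G ^ 2 * J ^ 2 * H ^ 2 * (4 * δ ^ 2 + 1) / (ε * σ ^ 2)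
      + 36 * L * σ ^ 2 * J ^ 2 / (ε ^ 2 * b₀ * M)) ≤ √(A + D) * y := by
    calc _ ≤ √((A + D) * y) := Real.sqrt_le_sqrt (by linarith)
      _ = √(A + D) * √y := Real.sqrt_mul (by positivity) _
      _ ≤ √(A + D) * y := by
        gcongr
        exact (Real.sqrt_le_left (by positivity)).mpr (by nlinarith)
  have t5 : 72 * L * σ ^ 2 * J ^ 2 / (ε ^ 2 * b₀ * M)
      = 2 * (36 * L * σ ^ 2 * J ^ 2 / (ε ^ 2 * b₀ * M)) := by ring
  have hit : iterationBound σ G L J ε b₀ M H δ ≤ (A + 2 * D + E * √(A + D)) * y := by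
    unfold iterationBound
    rw [t5]
    have := mul_le_mul t3 t4 (Real.sqrt_nonneg _) hE0.le
    linarith
  unfold roundBound
  rw [div_le_iff₀ (by positivity)]
  calc _ ≤ _ := hit
    _ = _ := by rw [hy]; ring

/-- This is the threshold on T at which Lη ≤ 1 becomes automatic. -/
theorem le_iterationBound_of_lt (hσ : 0 < σ) (hL : 0 < L) (hJ : 0 < J)
    (hε : 0 < ε) (hb : 1 ≤ b₀) (hM : 1 ≤ M) (hH : 1 ≤ H) (hεG : ε < G ^ 2) :
    b₀ * M * L * J ^ 2 / σ ^ 2 ≤ iterationBound σ G L J ε b₀ M H δ := by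
  have hb' : (0 : ℝ) < b₀ := by exact_mod_cast hb
  have hM' : (0 : ℝ) < M := by exact_mod_cast hM
  have hH' : (1 : ℝ) ≤ H := by exact_mod_cast hH
  have h1 : b₀ * M * L * J ^ 2 / σ ^ 2
      ≤ 8 * b₀ * M * L * G ^ 2 * J ^ 2 * H ^ 2 * (4 * δ ^ 2 + 1) / (ε * σ ^ 2) := by
    have e : 8 * b₀ * M * L * G ^ 2 * J ^ 2 * H ^ 2 * (4 * δ ^ 2 + 1) / (ε * σ ^ 2)
      = (b₀ * M * L * J ^ 2 / σ ^ 2) * ((G ^ 2 / ε) * (8 * H ^ 2 * (4 * δ ^ 2 + 1))) := by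
      field_simp
    rw [e]
    refine le_mul_of_one_le_right (by positivity) ?_
    refine one_le_mul_of_one_le_of_one_le ((one_le_div hε).mpr hεG.le) ?_
    nlinarith [sq_nonneg δ, sq_nonneg (H : ℝ), mul_nonneg (sq_nonneg (H : ℝ)) (sq_nonneg δ)]
  unfold iterationBound
  have h2 : 0 ≤ 72 * L * σ ^ 2 * J ^ 2 / (ε ^ 2 * b₀ * M) := by positivity
  have h3 : 0 ≤ 12 * σ * J * √L / (ε * √(M * b₀))
      * √(8 * b₀ * M * L * G ^ 2 * J ^ 2 * H ^ 2 * (4 * δ ^ 2 + 1) / (ε * σ ^ 2)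
          + 36 * L * σ ^ 2 * J ^ 2 / (ε ^ 2 * b₀ * M)) := by positivity
  linarith

end Parameters

/-! ### Measurability of the iterates. -/

section Measurability

variable {M d : ℕ} {Q : Problem M d} {b : ℕ → ℕ} {T H : ℕ} {k : Fin M → ℕ} {η : ℝ}

theorem measurable_gradient {d : ℕ} (f : Vec d → ℝ) : Measurable (gradient f) := by
  have : gradient f = fun x => (InnerProductSpace.toDual ℝ (Vec d)).symm (fderiv ℝ f x) := rfl
  rw [this]
  exact (InnerProductSpace.toDual ℝ (Vec d)).symm.continuous.measurable.comp (measurable_fderiv ℝ f)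

theorem measurable_path (hk : ∀ m, 1 ≤ k m ∧ k m ≤ d) (β : Batches Q b T) (t : ℕ) :
    Measurable (fun w => (path H k η w β t).w) ∧
      (∀ m, Measurable fun w => (path H k η w β t).what m) ∧
      ∀ m, Measurable fun w => (path H k η w β t).err m := by
  induction t with
  | zero => exact ⟨measurable_id, fun _ => measurable_id, fun _ => measurable_const⟩
  | succ t ih =>
    obtain ⟨hw, hwhat, herr⟩ := ih
    have hg : ∀ m, Measurable fun w => grads (path H k η w β t) β t m := fun m =>
      (Finset.measurable_sum _ fun j _ =>
        (measurable_gradient (Q.loss m (β.at m t j))).comp (hwhat m)).const_smul (1 / (b t : ℝ))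
    have hhalf : ∀ m, Measurable fun w =>
        (path H k η w β t).what m - η • grads (path H k η w β t) β t m := fun m =>
      (hwhat m).sub ((hg m).const_smul η)
    by_cases h : H ∣ t + 1
    · have hu : ∀ m, Measurable fun w => (path H k η w β t).err m + (path H k η w β t).w
          - ((path H k η w β t).what m - η • grads (path H k η w β t) β t m) := fun m =>
        ((herr m).add hw).sub (hhalf m)
      have htop := fun m => (measurable_topK (hk m).1 (hk m).2).comp (hu m)
      have hw' := hw.sub ((Finset.measurable_sum Finset.univ fun m _ => htop m).const_smul
        (1 / (M : ℝ)))
      simp only [path_succ, step, h, if_true]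
      exact ⟨hw', fun _ => hw', fun m => (hu m).sub (htop m)⟩
    · simp only [path_succ, step, h, if_false]
      exact ⟨hw, hhalf, herr⟩

/-- There are finitely many batch configurations, so measurability in the initial model for each one
suffices. -/
theorem measurable_path_what (hk : ∀ m, 1 ≤ k m ∧ k m ≤ d) (t : ℕ) (m : Fin M) :
    Measurable fun q : Vec d × Batches Q b T => (path H k η q.1 q.2 t).what m :=
  measurable_from_prod_countable_left fun β => (measurable_path hk β t).2.1 m

end Measurability

/-! ### From a fixed to a random initial model. -/

section RandomRun

variable {M d : ℕ} {Q : Problem M d} {S : Sampling} {b : ℕ → ℕ} {T H : ℕ} {k : Fin M → ℕ}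
  {η L G V : ℝ} {Ω : Type*} {w₀ : Ω → Vec d}
  {B : (m : Fin M) → (t : ℕ) → Ω → Fin (b t) → Fin (Q.n m)}

/-- The mini-batches of iterations `t < T` as a single random variable. -/
def jointBatch (T : ℕ) (B : (m : Fin M) → (t : ℕ) → Ω → Fin (b t) → Fin (Q.n m)) (ω : Ω) :
    Batches Q b T := fun p => B p.1 p.2 ω

theorem trajectory_eq_path (ω : Ω) {t : ℕ} (ht : t ≤ T) :
    trajectory Q H k η b (w₀ ω) (fun m t => B m t ω) t
      = path H k η (w₀ ω) (jointBatch T B ω) t := by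
  refine trajectory_congr H k η _ fun s hs m => ?_
  simp [Batches.at, jointBatch, hs.trans_le ht]

/-- Without learning, all local models stay at the initial model. -/
theorem path_of_zero_rate (w : Vec d) (β : Batches Q b T) (t : ℕ) :
    (path H k 0 w β t).w = w ∧ (∀ m, (path H k 0 w β t).what m = w) ∧
      ∀ m, (path H k 0 w β t).err m = 0 := by
  induction t with
  | zero => exact ⟨rfl, fun _ => rfl, fun _ => rfl⟩
  | succ t ih =>
    obtain ⟨h1, h2, h3⟩ := ih
    have h0 : ∀ m, topK (k m) (0 : Vec d) = 0 := fun m => by ext; simp [topK]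
    by_cases h : H ∣ t + 1 <;> simp [path_succ, step, h, h1, h2, h3, h0]

variable [MeasurableSpace Ω] {P : Measure Ω}

theorem IsRandomRun.measurable_jointBatch (hrun : IsRandomRun Q S T b P w₀ B) :
    Measurable (jointBatch T B) :=
  measurable_pi_lambda _ fun p => hrun.measurable_batch p.1 p.2 p.2.2

theorem IsRandomRun.measurable_what (hrun : IsRandomRun Q S T b P w₀ B)
    (hk : ∀ m, 1 ≤ k m ∧ k m ≤ d) {t : ℕ} (ht : t ≤ T) (m : Fin M) :
    Measurable fun ω => (trajectory Q H k η b (w₀ ω) (fun m t => B m t ω) t).what m := by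
  simp_rw [trajectory_eq_path _ ht]
  exact (measurable_path_what hk t m).comp
    (hrun.measurable_init.prodMk hrun.measurable_jointBatch)

variable [IsProbabilityMeasure P]

theorem IsRandomRun.isProbabilityMeasure (hrun : IsRandomRun Q S T b P w₀ B)
    (p : Fin M × Fin T) : IsProbabilityMeasure (uniformOn (S.batches (b p.2) (Q.n p.1))) := by
  rw [← hrun.law_batch p.1 p.2 p.2.2]
  exact Measure.isProbabilityMeasure_map (hrun.measurable_batch p.1 p.2 p.2.2).aemeasurable

/-- The product law allows the bound for deterministic starts to be integrated over the initial
model. -/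
theorem IsRandomRun.map_eq (hrun : IsRandomRun Q S T b P w₀ B) :
    P.map (fun ω => (w₀ ω, jointBatch T B ω)) = (P.map w₀).prod (batchLaw Q S b T) := by
  have h1 : P.map (jointBatch T B) = batchLaw Q S b T := by
    have := (iIndepFun_iff_map_fun_eq_pi_map fun p : Fin M × Fin T =>
      (hrun.measurable_batch p.1 p.2 p.2.2).aemeasurable).mp hrun.indep_batch
    unfold jointBatch batchLaw
    rw [this]
    congr 1
    funext p
    exact hrun.law_batch p.1 p.2 p.2.2
  rw [(indepFun_iff_map_prod_eq_prod_map_map hrun.measurable_init.aemeasurable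
    hrun.measurable_jointBatch.aemeasurable).mp hrun.indep_init, h1]

theorem reachesAccuracy_of_integral_le {X : Ω → ℕ → State M d} (hQ : Q.IsSmooth L) (hL : 0 < L)
    (hM : 1 ≤ M) (hT : 1 ≤ T)
    (hX : ∀ t < T, ∀ m, Measurable fun ω => (X ω t).what m)
    (hG : ∀ w, ‖gradient Q.globalLoss w‖ ^ 2 ≤ G ^ 2) {ε : ℝ}
    (h : ∫ ω, ∑ t ∈ Finset.range T, (1 / (M : ℝ)) *
      ∑ m, ‖gradient Q.globalLoss ((X ω t).what m)‖ ^ 2 ∂P ≤ T * ε) :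
    ReachesAccuracy Q T P X ε := by
  have hM' : (0 : ℝ) < M := by positivity
  have hT' : (0 : ℝ) < T := by positivity
  have hne : Nonempty (Fin M × Fin T) := ⟨(⟨0, hM⟩, ⟨0, hT⟩)⟩
  have hprob : IsProbabilityMeasure (uniformOn (Set.univ : Set (Fin M × Fin T))) :=
    isProbabilityMeasure_uniformOn Set.finite_univ Set.univ_nonempty
  have hmeas : Measurable fun q : Ω × (Fin M × Fin T) =>
      ‖gradient Q.globalLoss ((X q.1 q.2.2).what q.2.1)‖ ^ 2 := by
    refine Measurable.pow_const (Measurable.norm ?_) 2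
    refine (continuous_gradient_globalLoss hQ hL hM).measurable.comp ?_
    exact measurable_from_prod_countable_left fun p => hX p.2 p.2.2 p.1
  have hint : Integrable (fun q : Ω × (Fin M × Fin T) =>
      ‖gradient Q.globalLoss ((X q.1 q.2.2).what q.2.1)‖ ^ 2) (P.prod (uniformOn Set.univ)) :=
    Integrable.of_bound hmeas.aestronglyMeasurable (G ^ 2) (ae_of_all _ fun q => by
      rw [Real.norm_of_nonneg (sq_nonneg _)]; exact hG _)
  refine ⟨hint, ?_⟩
  simp only
  rw [integral_prod _ hint]
  have h1 : ∀ ω, ∫ p : Fin M × Fin T, ‖gradient Q.globalLoss ((X ω p.2).what p.1)‖ ^ 2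
      ∂(uniformOn Set.univ) = (T : ℝ)⁻¹ * ∑ t ∈ Finset.range T, (1 / (M : ℝ)) *
      ∑ m, ‖gradient Q.globalLoss ((X ω t).what m)‖ ^ 2 := by
    intro ω
    rw [← Finset.coe_univ, integral_uniformOn, Fintype.sum_prod_type_right, ← Finset.mul_sum,
      ← Fin.sum_univ_eq_sum_range
        (fun t => ∑ m, ‖gradient Q.globalLoss ((X ω t).what m)‖ ^ 2) T]
    simp
    ring
  simp_rw [h1]
  rw [integral_const_mul, inv_mul_le_iff₀ hT']
  exact h

theorem IsRandomRun.integral_sum_le (hrun : IsRandomRun Q S T b P w₀ B) (hQ : Q.IsSmooth L)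
    (hL : 0 < L) (hM : 1 ≤ M) (hH : 1 ≤ H) (hT : 1 ≤ T) (hη : 0 ≤ η) (hηL : L * η ≤ 1)
    (hG0 : 0 ≤ G) (hb : ∀ t < T, 1 ≤ b t)
    (hV : ∀ t < T, ∀ m w, ∫ B, ‖Q.batchGrad m B w - gradient (Q.localLoss m) w‖ ^ 2
      ∂(uniformOn (S.batches (b t) (Q.n m))) ≤ V)
    (hG : ∀ t < T, Q.BoundedSecondMoment S (b t) G) (hk : ∀ m, 1 ≤ k m ∧ k m ≤ d)
    (hbdd : BddBelow (Set.range Q.globalLoss)) (hint : Integrable (fun ω => Q.globalLoss (w₀ ω)) P) :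
    η * ∫ ω, ∑ t ∈ Finset.range T, (1 / (M : ℝ)) * ∑ m, ‖gradient Q.globalLoss
        ((trajectory Q H k η b (w₀ ω) (fun m t => B m t ω) t).what m)‖ ^ 2 ∂P
      ≤ 4 * ((∫ ω, Q.globalLoss (w₀ ω) ∂P) - Q.optValue) + η * T *
        (8 * L ^ 2 * (4 * rmsSparsity d k ^ 2 + 1) * (H * (η * G)) ^ 2 + 2 * L * η * (V / M)) := by
  have hprob := hrun.isProbabilityMeasure
  have hGw := norm_gradient_globalLoss_sq_le hQ hM hT (hb 0 hT) (hG 0 hT)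
  let Φ : Vec d × Batches Q b T → ℝ := fun q => ∑ t ∈ Finset.range T, (1 / (M : ℝ)) *
    ∑ m, ‖gradient Q.globalLoss ((path H k η q.1 q.2 t).what m)‖ ^ 2
  have hP : IsProbabilityMeasure (P.map w₀) :=
    Measure.isProbabilityMeasure_map hrun.measurable_init.aemeasurable
  have hterm : ∀ t m, Measurable fun q : Vec d × Batches Q b T =>
      ‖gradient Q.globalLoss ((path H k η q.1 q.2 t).what m)‖ ^ 2 := fun t m =>
    ((continuous_gradient_globalLoss hQ hL hM).measurable.comp
      (measurable_path_what hk t m)).norm.pow_const 2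
  have hΦm : Measurable Φ := Finset.measurable_sum _ fun t _ =>
    (Finset.measurable_sum _ fun m _ => hterm t m).const_mul _
  have hΦi : Integrable Φ ((P.map w₀).prod (batchLaw Q S b T)) :=
    integrable_finsetSum _ fun t _ => (integrable_finsetSum _ fun m _ =>
      Integrable.of_bound (hterm t m).aestronglyMeasurable (G ^ 2) (ae_of_all _ fun q => by
        rw [Real.norm_of_nonneg (sq_nonneg _)]; exact hGw _)).const_mul _
  have hFm : Measurable Q.globalLoss := (differentiable_globalLoss hQ).continuous.measurable
  have hFi : Integrable Q.globalLoss (P.map w₀) :=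
    (integrable_map_measure hFm.aestronglyMeasurable hrun.measurable_init.aemeasurable).mpr hint
  have h1 : ∫ ω, ∑ t ∈ Finset.range T, (1 / (M : ℝ)) * ∑ m, ‖gradient Q.globalLoss
        ((trajectory Q H k η b (w₀ ω) (fun m t => B m t ω) t).what m)‖ ^ 2 ∂P
      = ∫ w, ∫ β, Φ (w, β) ∂(batchLaw Q S b T) ∂(P.map w₀) := by
    rw [← integral_prod _ hΦi, ← hrun.map_eq, integral_map
      (hrun.measurable_init.prodMk hrun.measurable_jointBatch).aemeasurable
      hΦm.aestronglyMeasurable]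
    refine integral_congr_ae (ae_of_all _ fun ω => ?_)
    refine Finset.sum_congr rfl fun t ht => ?_
    rw [trajectory_eq_path ω (Finset.mem_range.mp ht).le]
  have h2 : ∫ ω, Q.globalLoss (w₀ ω) ∂P = ∫ w, Q.globalLoss w ∂(P.map w₀) :=
    (integral_map hrun.measurable_init.aemeasurable hFm.aestronglyMeasurable).symm
  rw [h1, h2, ← integral_const_mul]
  set R := η * T * (8 * L ^ 2 * (4 * rmsSparsity d k ^ 2 + 1) * (H * (η * G)) ^ 2
    + 2 * L * η * (V / M))
  have hi : Integrable (fun w => 4 * (Q.globalLoss w - Q.optValue)) (P.map w₀) :=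
    (hFi.sub (integrable_const Q.optValue)).const_mul 4
  refine (integral_mono (hΦi.integral_prod_left.const_mul η)
    (hi.add (integrable_const R)) fun w => ?_).trans_eq ?_
  · have := sum_integral_norm_gradient_sq_le hQ hL hM hH hη hηL hG0 hb hV hG hk hbdd w
    simp only [Φ]
    rw [integral_finsetSum _ fun _ _ => Integrable.of_finite]
    exact this
  · simp only [Pi.add_apply]
    rw [integral_add hi (integrable_const _),
      integral_const_mul, integral_sub hFi (integrable_const _)]
    simp

end RandomRun

/-! ### Inserting the learning rate. -/

section Rate

variable {σ G L J ε : ℝ} {b₀ M H T : ℕ}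

theorem sq_learningRate {Δ : ℝ} (hL : 0 < L) (hΔ : 0 ≤ Δ) :
    learningRate σ L b₀ M T Δ ^ 2 = b₀ * Δ / (σ ^ 2 * L) * M / T := by
  rw [learningRate, div_pow, mul_pow, Real.sq_sqrt (by positivity), Real.sq_sqrt (by positivity),
    Real.sq_sqrt (by positivity)]

theorem learningRate_mul_le_one {Δ : ℝ} (hσ : 0 < σ) (hL : 0 < L) (hΔ : 0 ≤ Δ) (hΔJ : Δ ≤ J ^ 2)
    (hT : 1 ≤ T) (h : b₀ * M * L * J ^ 2 / σ ^ 2 ≤ T) : L * learningRate σ L b₀ M T Δ ≤ 1 := by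
  have hT' : (0 : ℝ) < T := by exact_mod_cast hT
  have h0 : 0 ≤ learningRate σ L b₀ M T Δ := by unfold learningRate; positivity
  refine le_of_sq_le_sq ?_ zero_le_one
  rw [mul_pow, sq_learningRate hL hΔ, one_pow]
  have h1 : L ^ 2 * (b₀ * Δ / (σ ^ 2 * L) * M / T) = (b₀ * M * L * Δ / σ ^ 2) / T := by
    field_simp
  rw [h1, div_le_one hT']
  refine le_trans ?_ h
  gcongr

/-- With p = √(M T b₀) one has η = s p / (σ √L T). After division by ηT, the initial gap is 4 and
the noise at most 2c times s σ √L / p, within the 12c available. Here `v` is the variance in units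
of σ², and `c` the loss when `v` exceeds 1/b₀. -/
theorem rate_le_errorBound {s v c V δ : ℝ} (hσ : 0 < σ) (hL : 0 < L) (hb : 1 ≤ b₀) (hM : 1 ≤ M)
    (hT : 1 ≤ T) (hs : 0 < s) (hsJ : s ≤ J) (hc : 1 ≤ c) (hv : b₀ * v ≤ c) (hV : V ≤ σ ^ 2 * v)
    {η : ℝ} (hη : η = learningRate σ L b₀ M T (s ^ 2)) :
    4 * s ^ 2 + η * T * (8 * L ^ 2 * (4 * δ ^ 2 + 1) * (H * (η * G)) ^ 2 + 2 * L * η * (V / M))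
      ≤ η * (T * (c * errorBound σ G L J b₀ M H δ T)) := by
  have hb' : (0 : ℝ) < b₀ := by exact_mod_cast hb
  have hM' : (0 : ℝ) < M := by exact_mod_cast hM
  have hT' : (0 : ℝ) < T := by exact_mod_cast hT
  have hJ : 0 < J := hs.trans_le hsJ
  have hη2 := sq_learningRate (σ := σ) (b₀ := b₀) (M := M) (T := T) hL (sq_nonneg s)
  rw [← hη] at hη2
  set l := √L with hl
  set p := √(M * T * b₀ : ℝ) with hp
  have hl0 : 0 < l := Real.sqrt_pos.mpr hL
  have hp0 : 0 < p := Real.sqrt_pos.mpr (by positivity)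
  have hl2 : l ^ 2 = L := Real.sq_sqrt hL.le
  have hp2 : p ^ 2 = M * T * b₀ := Real.sq_sqrt (by positivity)
  have hη0 : 0 ≤ η := by rw [hη]; unfold learningRate; positivity
  have hηeq : η = s * p / (σ * l * T) := by
    rw [← sq_eq_sq₀ hη0 (by positivity), hη2, div_pow, mul_pow, mul_pow, mul_pow, hp2, hl2]
    field_simp
  have hηpos : 0 < η := by rw [hηeq]; positivity
  have e1 : 4 * s ^ 2 = η * T * (4 * (s * σ * l / p)) := by
    rw [hηeq]; field_simp
  have e2 : 8 * L ^ 2 * (4 * δ ^ 2 + 1) * (H * (η * G)) ^ 2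
      ≤ (4 * δ ^ 2 + 1) * (8 * b₀ * M * L * G ^ 2 * H ^ 2 * J ^ 2 / (σ ^ 2 * T)) := by
    have : 8 * L ^ 2 * (4 * δ ^ 2 + 1) * (H * (η * G)) ^ 2
        = (4 * δ ^ 2 + 1) * (8 * b₀ * M * L * G ^ 2 * H ^ 2 * s ^ 2 / (σ ^ 2 * T)) := by
      rw [mul_pow, mul_pow, hη2]; field_simp
    rw [this]
    gcongr
  have e3 : 2 * L * η * (V / M) ≤ 2 * c * (s * σ * l / p) := by
    have h1 : 2 * L * η * (σ ^ 2 * v / M) = 2 * (b₀ * v) * (s * σ * l / p) := by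
      have h2 : p / (M * T) = b₀ / p := by
        rw [div_eq_div_iff (by positivity) hp0.ne', ← sq, hp2]; ring
      calc 2 * L * η * (σ ^ 2 * v / M) = 2 * v * s * σ * l * (p / (M * T)) := by
            rw [hηeq, ← hl2]; field_simp
        _ = _ := by rw [h2]; ring
    calc 2 * L * η * (V / M) ≤ 2 * L * η * (σ ^ 2 * v / M) := by gcongr
      _ = 2 * (b₀ * v) * (s * σ * l / p) := h1
      _ ≤ _ := by gcongr
  have e4 : s * σ * l / p ≤ J * σ * l / p := by gcongr
  have e5 : errorBound σ G L J b₀ M H δ T = 12 * (J * σ * l / p)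
      + (4 * δ ^ 2 + 1) * (8 * b₀ * M * L * G ^ 2 * H ^ 2 * J ^ 2 / (σ ^ 2 * T)) := by
    rw [errorBound]; ring
  rw [e1, e5, ← mul_add, ← mul_assoc η]
  refine mul_le_mul_of_nonneg_left ?_ (by positivity)
  set x := s * σ * l / p
  set y := J * σ * l / p
  set z := (4 * δ ^ 2 + 1) * (8 * b₀ * M * L * G ^ 2 * H ^ 2 * J ^ 2 / (σ ^ 2 * T))
  have hx0 : 0 ≤ x := by positivity
  have hy0 : 0 ≤ y := by positivity
  have hz0 : 0 ≤ z := by positivity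
  nlinarith [mul_le_mul_of_nonneg_right hc hz0, mul_le_mul_of_nonneg_right hc hy0,
    mul_le_mul_of_nonneg_left e4 (by linarith : 0 ≤ c)]

theorem one_le_rmsSparsity {M d : ℕ} {k : Fin M → ℕ} (hM : 1 ≤ M)
    (hk : ∀ m, 1 ≤ k m ∧ k m ≤ d) : 1 ≤ rmsSparsity d k := by
  have hM' : (M : ℝ) ≠ 0 := by positivity
  rw [rmsSparsity, Real.one_le_sqrt]
  calc (1 : ℝ) = (1 / (M : ℝ)) * ∑ m : Fin M, 1 := by simp [hM']
    _ ≤ _ := by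
      gcongr with m
      have h1 : (0 : ℝ) < k m := by exact_mod_cast (hk m).1
      have h2 : (k m : ℝ) ≤ d := by exact_mod_cast (hk m).2
      exact one_le_pow₀ ((one_le_div h1).mpr h2)

theorem le_batchSize {T : ℕ} (hT : 2 ≤ T) (b₀ t : ℕ) : b₀ ≤ batchSize (rho T) b₀ t := by
  have hT' : (2 : ℝ) ≤ T := by exact_mod_cast hT
  have h : 1 ≤ rho T := by
    rw [rho, one_le_div (by linarith)]; linarith
  exact Nat.le_floor (le_mul_of_one_le_left (Nat.cast_nonneg _) (one_le_pow₀ h))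

end Rate

/-! ### Accuracy after sufficiently many iterations. -/

variable {M d : ℕ} {Q : Problem M d} {S : Sampling} {b : ℕ → ℕ} {T H b₀ : ℕ} {k : Fin M → ℕ}
  {σ G L J ε V : ℝ} {Ω : Type*} [MeasurableSpace Ω] {P : Measure Ω} [IsProbabilityMeasure P]
  {w₀ : Ω → Vec d} {B : (m : Fin M) → (t : ℕ) → Ω → Fin (b t) → Fin (Q.n m)}

/-- If the initial model is almost surely optimal, then nothing moves. -/
theorem reachesAccuracy_of_optimal (hQ : Q.IsSmooth L) (hL : 0 < L) (hM : 1 ≤ M) (hT : 1 ≤ T)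
    (hrun : IsRandomRun Q S T b P w₀ B) (hk : ∀ m, 1 ≤ k m ∧ k m ≤ d)
    (hGw : ∀ w, ‖gradient Q.globalLoss w‖ ^ 2 ≤ G ^ 2)
    (hbdd : BddBelow (Set.range Q.globalLoss)) (hint : Integrable (fun ω => Q.globalLoss (w₀ ω)) P)
    (hΔ : ∫ ω, Q.globalLoss (w₀ ω) ∂P = Q.optValue) (hε : 0 ≤ ε) :
    ReachesAccuracy Q T P
      (fun ω => trajectory Q H k 0 b (w₀ ω) (fun m t => B m t ω)) ε := by
  refine reachesAccuracy_of_integral_le hQ hL hM hT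
    (fun t ht m => hrun.measurable_what hk ht.le m) hGw ?_
  have h0 : ∫ ω, (Q.globalLoss (w₀ ω) - Q.optValue) ∂P = 0 := by
    rw [integral_sub hint (integrable_const _), hΔ]; simp
  have hae := (integral_eq_zero_iff_of_nonneg
    (fun ω => sub_nonneg.mpr (ciInf_le hbdd (w₀ ω))) (hint.sub (integrable_const _))).mp h0
  refine le_trans (le_of_eq (integral_eq_zero_of_ae ?_)) (by positivity)
  filter_upwards [hae] with ω hω
  have hgrad : gradient Q.globalLoss (w₀ ω) = 0 := by
    have hmin : IsLocalMin Q.globalLoss (w₀ ω) := Filter.Eventually.of_forall fun w => by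
      rw [sub_eq_zero.mp hω]
      exact ciInf_le hbdd w
    rw [gradient, hmin.fderiv_eq_zero, map_zero]
  refine Finset.sum_eq_zero fun t ht => ?_
  rw [trajectory_eq_path ω (Finset.mem_range.mp ht).le]
  simp [(path_of_zero_rate (H := H) (k := k) (w₀ ω) (jointBatch T B ω) t).2.1, hgrad]

/-- Serves both guarantees: (v, c) = (1, b₀) under the plain variance bound, and (1/b₀, 1) under the
single-sample bound. -/
theorem reachesAccuracy_of_iterationBound_le {v c : ℝ} (hσ : 0 < σ) (hG0 : 0 < G) (hL : 0 < L)
    (hJ : 0 < J) (hε : 0 < ε) (hb₀ : 1 ≤ b₀) (hM : 1 ≤ M) (hH : 1 ≤ H) (hT : 1 ≤ T)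
    (hk : ∀ m, 1 ≤ k m ∧ k m ≤ d) (hQ : Q.IsSmooth L) (hb : ∀ t < T, 1 ≤ b t)
    (hc : 1 ≤ c) (hv : b₀ * v ≤ c) (hV : ∀ t < T, ∀ m w, ∫ B,
      ‖Q.batchGrad m B w - gradient (Q.localLoss m) w‖ ^ 2
        ∂(uniformOn (S.batches (b t) (Q.n m))) ≤ σ ^ 2 * v)
    (hG : ∀ t < T, Q.BoundedSecondMoment S (b t) G)
    (hbdd : BddBelow (Set.range Q.globalLoss)) (hrun : IsRandomRun Q S T b P w₀ B)
    (hint : Integrable (fun ω => Q.globalLoss (w₀ ω)) P)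
    (hΔJ : (∫ ω, Q.globalLoss (w₀ ω) ∂P) - Q.optValue ≤ J ^ 2)
    (hTbound : iterationBound σ G L J ε b₀ M H (rmsSparsity d k) ≤ T) :
    ReachesAccuracy Q T P (fun ω => trajectory Q H k
      (learningRate σ L b₀ M T ((∫ ω, Q.globalLoss (w₀ ω) ∂P) - Q.optValue)) b (w₀ ω)
      (fun m t => B m t ω)) (c * ε) := by
  have hprob := hrun.isProbabilityMeasure
  have hGw := norm_gradient_globalLoss_sq_le hQ hM hT (hb 0 hT) (hG 0 hT)
  have hM' : (0 : ℝ) < M := by exact_mod_cast hM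
  have hT' : (0 : ℝ) < T := by exact_mod_cast hT
  set Δ := (∫ ω, Q.globalLoss (w₀ ω) ∂P) - Q.optValue with hΔ
  have hΔ0 : 0 ≤ Δ := by
    have h1 : ∫ _ : Ω, Q.optValue ∂P ≤ ∫ ω, Q.globalLoss (w₀ ω) ∂P :=
      integral_mono (integrable_const _) hint fun ω => ciInf_le hbdd (w₀ ω)
    simp only [integral_const, probReal_univ, smul_eq_mul, one_mul] at h1
    linarith
  -- A zero gap gives η = 0, so the factor η in the convergence bound could not be cancelled.
  rcases hΔ0.eq_or_lt with h0 | hΔpos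
  · have hη : learningRate σ L b₀ M T Δ = 0 := by rw [← h0]; simp [learningRate]
    rw [hη]
    exact reachesAccuracy_of_optimal hQ hL hM hT hrun hk hGw hbdd hint (by linarith)
      (by positivity)
  refine reachesAccuracy_of_integral_le hQ hL hM hT
    (fun t ht m => hrun.measurable_what hk ht.le m) hGw ?_
  rcases le_or_gt (G ^ 2) ε with hεG | hεG
  · have hcε : G ^ 2 ≤ c * ε := hεG.trans (le_mul_of_one_le_left hε.le hc)
    set f : Ω → ℝ := fun ω => ∑ t ∈ Finset.range T, (1 / (M : ℝ)) *
      ∑ m, ‖gradient Q.globalLoss ((trajectory Q H k (learningRate σ L b₀ M T Δ) b (w₀ ω)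
        (fun m t => B m t ω) t).what m)‖ ^ 2 with hf
    have h1 : ∀ ω, f ω ≤ T * G ^ 2 := by
      intro ω
      calc f ω ≤ ∑ t ∈ Finset.range T, (1 / (M : ℝ)) * ∑ m : Fin M, G ^ 2 := by
            refine Finset.sum_le_sum fun t _ => mul_le_mul_of_nonneg_left ?_ (by positivity)
            exact Finset.sum_le_sum fun m _ => hGw _
        _ = T * G ^ 2 := by simp [hM'.ne']
    calc ∫ ω, f ω ∂P ≤ ∫ _ : Ω, T * G ^ 2 ∂P :=
          integral_mono_of_nonneg (ae_of_all _ fun ω => by positivity) (integrable_const _)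
            (ae_of_all _ h1)
      _ = T * G ^ 2 := by simp
      _ ≤ _ := by gcongr
  set η := learningRate σ L b₀ M T Δ with hη
  have hη0 : 0 < η := by
    have hb' : (0 : ℝ) < b₀ := by exact_mod_cast hb₀
    rw [hη]; unfold learningRate; positivity
  have hηL : L * η ≤ 1 := learningRate_mul_le_one hσ hL hΔ0 hΔJ hT
    ((le_iterationBound_of_lt hσ hL hJ hε hb₀ hM hH hεG).trans hTbound)
  have h1 := hrun.integral_sum_le hQ hL hM hH hT hη0.le hηL hG0.le hb hV hG hk hbdd hint
  have hsq : √Δ ^ 2 = Δ := Real.sq_sqrt hΔ0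
  have h2 := rate_le_errorBound (G := G) (H := H) (V := σ ^ 2 * v) (δ := rmsSparsity d k)
    hσ hL hb₀ hM hT (Real.sqrt_pos.mpr hΔpos) ((Real.sqrt_le_left hJ.le).mpr hΔJ) hc hv le_rfl
    (by rw [hsq])
  rw [hsq, ← hη] at h2
  have h3 : errorBound σ G L J b₀ M H (rmsSparsity d k) T ≤ ε :=
    (errorBound_anti hσ hL hJ hb₀ hM (iterationBound_pos hσ hG0 hL hJ hε hb₀ hM hH)
      hTbound).trans_eq (errorBound_iterationBound hσ hG0 hL hJ hε hb₀ hM hH)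
  refine (le_of_mul_le_mul_left (h1.trans h2) hη0).trans ?_
  gcongr

end FTLSGD

theorem corollary1 (σ G L J ε : ℝ) (b₀ : ℕ) (hσ : 0 < σ) (hG : σ ≤ G) (hL : 0 < L)
    (hJ : 0 < J) (hε : 0 < ε) (hb : 1 ≤ b₀) :
    ∃ C : ℝ, 0 < C ∧
      -- the explicit number of rounds solves `errorBound = ε` and has the stated order
      (∀ (M H : ℕ) (δ : ℝ), 1 ≤ M → 1 ≤ H → 1 ≤ δ →
        0 < iterationBound σ G L J ε b₀ M H δ ∧
        errorBound σ G L J b₀ M H δ (iterationBound σ G L J ε b₀ M H δ) = ε ∧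
        roundBound σ G L J ε b₀ M H δ ≤ C * (M * H * δ ^ 2) + C * (1 / (√M * H))) ∧
      -- guarantees for every run of the algorithm with `K` communication rounds
      (∀ (M H d K T : ℕ) (k : Fin M → ℕ) (Q : Problem M d) (S : Sampling)
        (Ω : Type*) [MeasurableSpace Ω] (P : Measure Ω) [IsProbabilityMeasure P]
        (w₀ : Ω → Vec d)
        (B : (m : Fin M) → (t : ℕ) → Ω → Fin (batchSize (rho T) b₀ t) → Fin (Q.n m)),
        1 ≤ M → 1 ≤ H → T = K * H → 2 ≤ T →
        (∀ m, 1 ≤ k m ∧ k m ≤ d) →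
        Q.IsSmooth L →
        (∀ t < T, Q.BoundedVariance S (batchSize (rho T) b₀ t) σ) →
        (∀ t < T, Q.BoundedSecondMoment S (batchSize (rho T) b₀ t) G) →
        BddBelow (Set.range Q.globalLoss) →
        IsRandomRun Q S T (batchSize (rho T) b₀) P w₀ B →
        Integrable (fun ω => Q.globalLoss (w₀ ω)) P →
        (∫ ω, Q.globalLoss (w₀ ω) ∂P) - Q.optValue ≤ J ^ 2 →
        let δ : ℝ := rmsSparsity d k
        let η : ℝ := learningRate σ L b₀ M T ((∫ ω, Q.globalLoss (w₀ ω) ∂P) - Q.optValue)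
        let X : Ω → ℕ → State M d := fun ω =>
          trajectory Q H k η (batchSize (rho T) b₀) (w₀ ω) (fun m t => B m t ω)
        (C * (M * H * δ ^ 2) + C * (1 / (√M * H)) ≤ K → ReachesAccuracy Q T P X ε) ∧
        (Q.BoundedVariance S 1 σ → roundBound σ G L J ε b₀ M H δ ≤ K →
          ReachesAccuracy Q T P X ε)) := by
  have hG0 : 0 < G := hσ.trans_le hG
  have hb' : (0 : ℝ) < b₀ := by exact_mod_cast hb
  obtain ⟨C₁, hC₁, h₁⟩ := exists_roundBound_le hσ hG0 hL hJ hε hb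
  -- Target ε/b₀ compensates the factor c = b₀ in the first guarantee.
  obtain ⟨C₂, hC₂, h₂⟩ := exists_roundBound_le hσ hG0 hL hJ (div_pos hε hb') hb
  refine ⟨C₁ + C₂, by positivity, fun M H δ hM hH hδ => ⟨?_, ?_, ?_⟩, ?_⟩
  · exact iterationBound_pos hσ hG0 hL hJ hε hb hM hH
  · exact errorBound_iterationBound hσ hG0 hL hJ hε hb hM hH
  · refine (h₁ M H δ hM hH hδ).trans ?_
    have h3 : 0 ≤ C₂ * (M * H * δ ^ 2) := by positivity
    have h4 : 0 ≤ (C₁ + C₂) * (1 / (√M * H)) := by positivity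
    linarith
  intro M H d K T k Q S Ω _ P _ w₀ B hM hH hTK hT2 hk hQ hvar hmom hbdd hrun hint hΔJ δ η X
  have hH' : (0 : ℝ) < H := by exact_mod_cast hH
  have hT1 : 1 ≤ T := by omega
  have hbt : ∀ t, b₀ ≤ batchSize (rho T) b₀ t := le_batchSize hT2 b₀
  have hT : (T : ℝ) = K * H := by exact_mod_cast hTK
  have hδ : 1 ≤ δ := one_le_rmsSparsity hM hk
  constructor
  · intro hK
    have hbound : iterationBound σ G L J (ε / b₀) b₀ M H δ ≤ T := by
      rw [hT, ← div_le_iff₀ hH']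
      refine le_trans (h₂ M H δ hM hH hδ) (le_trans ?_ hK)
      have h3 : 0 ≤ C₁ * (M * H * δ ^ 2) := by positivity
      have h4 : 0 ≤ (C₁ + C₂) * (1 / (√M * H)) := by positivity
      linarith
    have h := reachesAccuracy_of_iterationBound_le (v := 1) (c := b₀) hσ hG0 hL hJ
      (div_pos hε hb') hb hM hH hT1 hk hQ (fun t _ => hb.trans (hbt t)) (by exact_mod_cast hb)
      (by simp) (fun t ht m w => by rw [mul_one]; exact hvar t ht m w) hmom hbdd hrun hint hΔJ
      hbound
    rwa [mul_div_cancel₀ _ hb'.ne'] at h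
  · intro hvar1 hK
    have hbound : iterationBound σ G L J ε b₀ M H δ ≤ T := by
      rw [hT, ← div_le_iff₀ hH']
      exact hK
    have h := reachesAccuracy_of_iterationBound_le (v := (b₀ : ℝ)⁻¹) (c := 1) hσ hG0 hL hJ
      hε hb hM hH hT1 hk hQ (fun t _ => hb.trans (hbt t)) le_rfl
      (mul_inv_cancel₀ hb'.ne').le (fun t ht m w => by
        have := hrun.isProbabilityMeasure (m, ⟨t, ht⟩)
        refine (integral_norm_batchGrad_sub_sq_le Q hQ.1 (hb.trans (hbt t)) m hvar1 w).trans ?_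
        rw [div_eq_mul_inv]
        have := hbt t
        gcongr) hmom hbdd hrun hint hΔJ hbound
    rwa [one_mul] at h
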